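/- Let $\mathsf{RCA}_0^\omega=\mathsf{E\text{-}PRA}^\omega+\mathsf{QF\text{-}AC}^{1,0}$ be Kohlenbach's base theory of higher-order reverse mathematics: many-sorted classical logic over all finite types, with $=_0$ as the only primitive relation (equality at higher types being defined extensionally), constants $0$, $S$, the combinators $\Pi,\Sigma$ and the type-$0$ recursor $R_0$, with quantifier-free induction, the axiom of extensionality in all finite types, and choice $(\forall f^1)(\exists n^0)A_0(f,n)\to(\exists F^2)(\forall f^1)A_0(f,F(f))$ for quantifier-free $A_0$. Sets of numbers are given by characteristic functions, and linear orders $X^1$ are sets of coded pairs; $X$ is infinite if its field is not bounded by any number. A suborder $Y$ of $X$ (a subset of the field of $X$, with the induced order $\le_Y$) is stable if it is infinite, every element except for the first one (if any) has an immediate predecessor, every element except for the last one (if any) has an immediate successor, and every element has finitely many predecessors or finitely many successors. For $\Phi=(\Phi_1,\Phi_2)$ of type $1\to(1\times1)$, let $\mathsf{UCADS}(\Phi)$ say that for every infinite linear order $X$, $Y=\Phi_1(X)$ is a stable suborder of $X$, and for all $y\in Y$ $$(\forall w^0)\big(y\le_Y w\to w\le_Y\Phi_2(X)(y)\big)\ \vee\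 (\forall v^0)\big(y\ge_Y v\to v\ge_Y\Phi_2(X)(y)\big).$$ Let $\mathsf{MU}(\mu)$ say that $(\forall f^1)\big((\exists n)f(n)=0\to f(\mu(f))=0\big)$. The principle $\mathsf{UCADS}$ is $(\exists\Phi)\,\mathsf{UCADS}(\Phi)$, and $(\mu^2)$ is $(\exists\mu^2)\,\mathsf{MU}(\mu)$. Theorem. $\mathsf{RCA}_0^\omega$ proves the explicit equivalence $\mathsf{UCADS}\leftrightarrow(\mu^2)$. That is: 1. $\mathsf{RCA}_0^\omega\vdash\mathsf{UCADS}\leftrightarrow(\mu^2)$. 2. There is a closed term $s$ (a pair of terms $s_1,s_2$) of the language such that $\mathsf{RCA}_0^\omega\vdash(\forall\mu^2)\big[\mathsf{MU}(\mu)\to\mathsf{UCADS}(s(\mu))\big]$. 3. There is a closed term $u$ of the language such that $\mathsf{RCA}_0^\omega$ proves: for all $\Phi,\Xi,Z$, if $\mathsf{UCADS}(\Phi)$ holds, $\Xi$ is an extensionality functional for $\Phi$ (if $f,g$ agree below $\Xi(f,g,k)$, then both components of $\Phi(f)$ and $\Phi(g)$ agree below $k$), and $Z$ witnesses that the suborders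 are infinite ($Z(X,k)>k$ and $Z(X,k)\in\Phi_1(X)$ for every infinite linear order $X$ and every $k$), then $\mathsf{MU}(u(\Phi,\Xi,Z))$. Moreover, $\mathsf{RCA}_0^\omega$ proves that such $\Xi$ and $Z$ exist for every $\Phi$ with $\mathsf{UCADS}(\Phi)$. -/

import Mathlib

namespace HigherOrder

/-- The finite types: `0` (here `N`) and, with `ρ` and `τ`, the function type `ρ ⇒ τ`. -/
inductive Ty : Type
  | N : Ty
  | arrow : Ty → Ty → Ty

infixr:60 " ⇒ " => Ty.arrow

/-- The type `1 = 0 → 0`. -/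
abbrev Ty.one : Ty := Ty.N ⇒ Ty.N

/-- The type `2 = 1 → 0`. -/
abbrev Ty.two : Ty := Ty.one ⇒ Ty.N

/-- The family of variables `V` with one further variable `new`, of type `τ`. -/
inductive Ext (V : Ty → Type) (τ : Ty) : Ty → Type
  | new : Ext V τ τ
  | old {σ : Ty} : V σ → Ext V τ σ

/-- No variables at all. -/
abbrev NoVar : Ty → Type := fun _ => Empty

/-- The constants of `E-PRA^ω`: zero, successor, the combinators `Π` and `Σ` in all types, and the
recursor `R₀` of type `0` (there are no recursors of higher type). -/
inductive Const : Ty → Type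
  | zero : Const Ty.N
  | succ : Const Ty.one
  | K (ρ τ : Ty) : Const (ρ ⇒ τ ⇒ ρ)
  | S (δ ρ τ : Ty) : Const ((δ ⇒ ρ ⇒ τ) ⇒ (δ ⇒ ρ) ⇒ δ ⇒ τ)
  | R : Const (Ty.N ⇒ Ty.N ⇒ (Ty.N ⇒ Ty.N ⇒ Ty.N) ⇒ Ty.N)

/-- The terms of the language; `Term V τ` are those of type `τ` with free variables from `V`. -/
inductive Term (V : Ty → Type) : Ty → Type
  | var {τ : Ty} : V τ → Term V τ
  | const {τ : Ty} : Const τ → Term V τ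
  | app {ρ τ : Ty} : Term V (ρ ⇒ τ) → Term V ρ → Term V τ

infixl:75 " ⬝ " => Term.app

/-- Closed terms. -/
abbrev ClosedTerm (τ : Ty) : Type := Term NoVar τ

namespace Term

variable {V W : Ty → Type}

/-- Simultaneous substitution of terms for variables. -/
def subst (σ : ∀ τ, V τ → Term W τ) : ∀ {τ : Ty}, Term V τ → Term W τ
  | _, var x => σ _ x
  | _, const c => const c
  | _, app s t => app (subst σ s) (subst σ t)

/-- The same term, with one more variable allowed. -/
def wk {τ ρ : Ty} (t : Term V τ) : Term (Ext V ρ) τ :=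
  t.subst fun _ x => var (Ext.old x)

/-- A closed term as a term over any family of variables. -/
def ofClosed {τ : Ty} (t : ClosedTerm τ) : Term V τ :=
  t.subst fun _ x => nomatch x

/-- The most recently bound variable. -/
abbrev v0 {τ : Ty} : Term (Ext V τ) τ := var Ext.new

/-- The variable bound one step before `v0`. -/
abbrev v1 {τ ρ : Ty} : Term (Ext (Ext V τ) ρ) τ := var (Ext.old Ext.new)

/-- The variable bound one step before `v1`. -/
abbrev v2 {τ ρ δ : Ty} : Term (Ext (Ext (Ext V τ) ρ) δ) τ := var (Ext.old (Ext.old Ext.new))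

/-- The variable bound one step before `v2`. -/
abbrev v3 {τ ρ δ κ : Ty} : Term (Ext (Ext (Ext (Ext V τ) ρ) δ) κ) τ :=
  var (Ext.old (Ext.old (Ext.old Ext.new)))

abbrev K {ρ τ : Ty} : Term V (ρ ⇒ τ ⇒ ρ) := const (Const.K ρ τ)

abbrev S {δ ρ τ : Ty} : Term V ((δ ⇒ ρ ⇒ τ) ⇒ (δ ⇒ ρ) ⇒ δ ⇒ τ) := const (Const.S δ ρ τ)

abbrev R : Term V (Ty.N ⇒ Ty.N ⇒ (Ty.N ⇒ Ty.N ⇒ Ty.N) ⇒ Ty.N) := const Const.R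

abbrev zero : Term V Ty.N := const Const.zero

abbrev succ (t : Term V Ty.N) : Term V Ty.N := const Const.succ ⬝ t

/-- Lambda abstraction of the newest variable, by means of the combinators. -/
def lam {τ : Ty} : ∀ {ρ : Ty}, Term (Ext V τ) ρ → Term V (τ ⇒ ρ)
  | _, var Ext.new => S ⬝ K ⬝ (K : Term V (τ ⇒ τ ⇒ τ))
  | _, var (Ext.old x) => K ⬝ var x
  | _, const c => K ⬝ const c
  | _, app s t => S ⬝ lam s ⬝ lam t

/-- Addition: `s + 0 = s` and `s + (t + 1) = (s + t) + 1`. -/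
def add (s t : Term V Ty.N) : Term V Ty.N := R ⬝ t ⬝ s ⬝ lam (lam (succ v1))

/-- Multiplication: `s * 0 = 0` and `s * (t + 1) = s * t + s`. -/
def mul (s t : Term V Ty.N) : Term V Ty.N := R ⬝ t ⬝ zero ⬝ lam (lam (add v1 s.wk.wk))

/-- The code `(s + t)² + s` of the pair `(s, t)`. -/
def pair (s t : Term V Ty.N) : Term V Ty.N := add (mul (add s t) (add s t)) s

end Term

open Term

/-- The formulas of the language. Equality of numbers is the only primitive relation, and the
logic is classical, so that `⊥`, `→` and `∀` (over every finite type) suffice. -/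
inductive Formula : (Ty → Type) → Type 1
  | eq {V : Ty → Type} : Term V Ty.N → Term V Ty.N → Formula V
  | bot {V : Ty → Type} : Formula V
  | imp {V : Ty → Type} : Formula V → Formula V → Formula V
  | all {V : Ty → Type} (τ : Ty) : Formula (Ext V τ) → Formula V

/-- Closed formulas. -/
abbrev Sentence : Type 1 := Formula NoVar

infix:50 " ≐ " => Formula.eq
infixr:25 " →ᶠ " => Formula.imp

/-- A substitution, taken below a quantifier over type `ρ`. -/
def liftSubst {V W : Ty → Type} {ρ : Ty} (σ : ∀ τ, V τ → Term W τ) :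
    ∀ τ, Ext V ρ τ → Term (Ext W ρ) τ
  | _, Ext.new => v0
  | _, Ext.old x => (σ _ x).wk

namespace Formula

/-- Simultaneous (capture-free) substitution of terms for free variables. -/
def subst : ∀ {V W : Ty → Type}, (∀ τ, V τ → Term W τ) → Formula V → Formula W
  | _, _, σ, eq s t => eq (s.subst σ) (t.subst σ)
  | _, _, _, bot => bot
  | _, _, σ, imp φ ψ => imp (subst σ φ) (subst σ ψ)
  | _, _, σ, all τ φ => all τ (subst (liftSubst σ) φ)

variable {V : Ty → Type}

/-- The same formula, with one more variable allowed. -/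
def wk {ρ : Ty} (φ : Formula V) : Formula (Ext V ρ) :=
  φ.subst fun _ x => var (Ext.old x)

/-- The substitution of `t` for the newest variable. -/
def instSubst {ρ : Ty} (t : Term V ρ) : ∀ τ, Ext V ρ τ → Term V τ
  | _, Ext.new => t
  | _, Ext.old x => var x

/-- The result `φ(t)` of substituting `t` for the newest variable. -/
def inst {ρ : Ty} (φ : Formula (Ext V ρ)) (t : Term V ρ) : Formula V :=
  φ.subst (instSubst t)

def not (φ : Formula V) : Formula V := φ →ᶠ bot

def and (φ ψ : Formula V) : Formula V := not (φ →ᶠ not ψ)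

def or (φ ψ : Formula V) : Formula V := not φ →ᶠ ψ

def iff (φ ψ : Formula V) : Formula V := and (φ →ᶠ ψ) (ψ →ᶠ φ)

def ex (τ : Ty) (φ : Formula (Ext V τ)) : Formula V := not (all τ (not φ))

/-- Quantifier-free formulas (whose terms may contain variables of any type). -/
inductive QF {V : Ty → Type} : Formula V → Prop
  | eq (s t : Term V Ty.N) : QF (eq s t)
  | bot : QF bot
  | imp {φ ψ : Formula V} : QF φ → QF ψ → QF (imp φ ψ)

end Formula

open Formula

infixr:35 " ∧ᶠ " => Formula.and
infixr:30 " ∨ᶠ " => Formula.or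
infix:20 " ↔ᶠ " => Formula.iff

section Theory

variable {V : Ty → Type}

/-- Extensional equality `s =_τ t` in all finite types. -/
def eqT : ∀ {V : Ty → Type} (τ : Ty), Term V τ → Term V τ → Formula V
  | _, Ty.N, s, t => s ≐ t
  | _, ρ ⇒ τ, s, t => all ρ (eqT τ (s.wk ⬝ v0) (t.wk ⬝ v0))

/-- In a formula `A(x)`, put `x + 1` in place of `x`. -/
def succSubst : ∀ τ, Ext V Ty.N τ → Term (Ext V Ty.N) τ
  | _, Ext.new => succ v0
  | _, Ext.old x => var (Ext.old x)

/-- In a formula `A(f, n)`, put `F(f)` in place of `n`, the new variables being `F` and `f`. -/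
def choiceSubst : ∀ τ, Ext (Ext V Ty.one) Ty.N τ → Term (Ext (Ext V Ty.two) Ty.one) τ
  | _, Ext.new => v1 ⬝ v0
  | _, Ext.old Ext.new => v0
  | _, Ext.old (Ext.old x) => var (Ext.old (Ext.old x))

/-- The axioms of `RCA₀^ω = E-PRA^ω + QF-AC^{1,0}`. Free variables (parameters) of any finite type
are allowed in all of them, and may be quantified universally by the logical rules. -/
inductive Axiom : ∀ {V : Ty → Type}, Formula V → Prop
  | refl {V : Ty → Type} (t : Term V Ty.N) : Axiom (t ≐ t)
  | symm {V : Ty → Type} (s t : Term V Ty.N) : Axiom (s ≐ t →ᶠ t ≐ s)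
  | trans {V : Ty → Type} (r s t : Term V Ty.N) : Axiom (r ≐ s →ᶠ s ≐ t →ᶠ r ≐ t)
  | succ_ne_zero {V : Ty → Type} (t : Term V Ty.N) : Axiom (succ t ≐ zero →ᶠ bot)
  | succ_inj {V : Ty → Type} (s t : Term V Ty.N) : Axiom (succ s ≐ succ t →ᶠ s ≐ t)
  | K_eq {V : Ty → Type} {ρ τ : Ty} (x : Term V ρ) (y : Term V τ) :
      Axiom (eqT ρ (K ⬝ x ⬝ y) x)
  | S_eq {V : Ty → Type} {δ ρ τ : Ty} (x : Term V (δ ⇒ ρ ⇒ τ)) (y : Term V (δ ⇒ ρ))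
      (z : Term V δ) : Axiom (eqT τ (S ⬝ x ⬝ y ⬝ z) (x ⬝ z ⬝ (y ⬝ z)))
  | R_zero {V : Ty → Type} (y : Term V Ty.N) (z : Term V (Ty.N ⇒ Ty.N ⇒ Ty.N)) :
      Axiom (R ⬝ zero ⬝ y ⬝ z ≐ y)
  | R_succ {V : Ty → Type} (x y : Term V Ty.N) (z : Term V (Ty.N ⇒ Ty.N ⇒ Ty.N)) :
      Axiom (R ⬝ succ x ⬝ y ⬝ z ≐ z ⬝ (R ⬝ x ⬝ y ⬝ z) ⬝ x)
  /-- The axiom of extensionality, in all finite types. -/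
  | extensionality {V : Ty → Type} {ρ τ : Ty} (z : Term V (ρ ⇒ τ)) (x y : Term V ρ) :
      Axiom (eqT ρ x y →ᶠ eqT τ (z ⬝ x) (z ⬝ y))
  /-- Quantifier-free induction. -/
  | induction {V : Ty → Type} (φ : Formula (Ext V Ty.N)) (h : QF φ) :
      Axiom (φ.inst zero →ᶠ all Ty.N (φ →ᶠ φ.subst succSubst) →ᶠ all Ty.N φ)
  /-- `QF-AC^{1,0}`: if for all `f` of type `1` there is a number `n` with `A(f, n)`, then there is
  a functional `F` of type `2` such that `A(f, F(f))` for all `f`. -/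
  | choice {V : Ty → Type} (φ : Formula (Ext (Ext V Ty.one) Ty.N)) (h : QF φ) :
      Axiom (all Ty.one (ex Ty.N φ) →ᶠ ex Ty.two (all Ty.one (φ.subst choiceSubst)))

/-- Derivability in `RCA₀^ω` from the assumptions in `Γ`: natural deduction for many-sorted
classical logic, with the above axioms. -/
inductive Derives : ∀ {V : Ty → Type}, Set (Formula V) → Formula V → Prop
  | hyp {V : Ty → Type} {Γ : Set (Formula V)} {φ : Formula V} : φ ∈ Γ → Derives Γ φ
  | ax {V : Ty → Type} {Γ : Set (Formula V)} {φ : Formula V} : Axiom φ → Derives Γ φ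
  | impI {V : Ty → Type} {Γ : Set (Formula V)} {φ ψ : Formula V} :
      Derives (insert φ Γ) ψ → Derives Γ (φ →ᶠ ψ)
  | impE {V : Ty → Type} {Γ : Set (Formula V)} {φ ψ : Formula V} :
      Derives Γ (φ →ᶠ ψ) → Derives Γ φ → Derives Γ ψ
  | raa {V : Ty → Type} {Γ : Set (Formula V)} {φ : Formula V} :
      Derives (insert (not φ) Γ) bot → Derives Γ φ
  | allI {V : Ty → Type} {Γ : Set (Formula V)} {τ : Ty} {φ : Formula (Ext V τ)} :
      Derives (Formula.wk '' Γ) φ → Derives Γ (all τ φ)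
  | allE {V : Ty → Type} {Γ : Set (Formula V)} {τ : Ty} {φ : Formula (Ext V τ)} (t : Term V τ) :
      Derives Γ (all τ φ) → Derives Γ (φ.inst t)

/-- `RCA₀^ω` proves the sentence `φ`. -/
def ProvableInRCA (φ : Sentence) : Prop := Derives ∅ φ

end Theory

section Principles

variable {V : Ty → Type}

/-- `s ≤ t` for numbers. -/
def le (s t : Term V Ty.N) : Formula V := ex Ty.N (add s.wk v0 ≐ t.wk)

/-- `s < t` for numbers. -/
def lt (s t : Term V Ty.N) : Formula V := le (succ s) t

/-- `X` is (the characteristic function of) a set of numbers. -/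
def isSet (X : Term V Ty.one) : Formula V := all Ty.N (le (X.wk ⬝ v0) (succ zero))

/-- `s ∈ X`. -/
def mem (s : Term V Ty.N) (X : Term V Ty.one) : Formula V := X ⬝ s ≐ succ zero

/-- `X`, a set of numbers, is infinite, i.e. not bounded by any number. -/
def infinite (X : Term V Ty.one) : Formula V :=
  all Ty.N (ex Ty.N (lt v1 v0 ∧ᶠ mem v0 X.wk.wk))

/-- `s ≤_X t`: the pair `(s, t)` is in `X`. -/
def leX (X : Term V Ty.one) (s t : Term V Ty.N) : Formula V := mem (pair s t) X

/-- `s <_X t`. -/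
def ltX (X : Term V Ty.one) (s t : Term V Ty.N) : Formula V := leX X s t ∧ᶠ not (leX X t s)

/-- `LO(X)`: the set `X` of pairs is a (reflexive) linear order on its field
`{i : (i, i) ∈ X}`. -/
def LO (X : Term V Ty.one) : Formula V :=
  isSet X
  ∧ᶠ all Ty.N (all Ty.N
      (leX X.wk.wk v1 v0 →ᶠ leX X.wk.wk v1 v1 ∧ᶠ leX X.wk.wk v0 v0))
  ∧ᶠ all Ty.N (all Ty.N (all Ty.N
      (leX X.wk.wk.wk v2 v1 →ᶠ leX X.wk.wk.wk v1 v0 →ᶠ leX X.wk.wk.wk v2 v0)))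
  ∧ᶠ all Ty.N (all Ty.N (leX X.wk.wk v1 v0 →ᶠ leX X.wk.wk v0 v1 →ᶠ v1 ≐ v0))
  ∧ᶠ all Ty.N (all Ty.N
      (leX X.wk.wk v1 v1 →ᶠ leX X.wk.wk v0 v0 →ᶠ leX X.wk.wk v1 v0 ∨ᶠ leX X.wk.wk v0 v1))

/-- `X` is an infinite linear order, i.e. its field is not bounded by any number. -/
def LOinf (X : Term V Ty.one) : Formula V :=
  LO X ∧ᶠ all Ty.N (ex Ty.N (lt v1 v0 ∧ᶠ leX X.wk.wk v0 v0))

/-- `s ≤_Y t` for the suborder of `X` on the set `Y`. -/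
def leY (X Y : Term V Ty.one) (s t : Term V Ty.N) : Formula V :=
  mem s Y ∧ᶠ mem t Y ∧ᶠ leX X s t

/-- `s <_Y t` for the suborder of `X` on the set `Y`. -/
def ltY (X Y : Term V Ty.one) (s t : Term V Ty.N) : Formula V :=
  mem s Y ∧ᶠ mem t Y ∧ᶠ ltX X s t

/-- `Y` is a subset of the field of `X`, and thus gives a suborder of `X`. -/
def suborder (X Y : Term V Ty.one) : Formula V :=
  isSet Y ∧ᶠ all Ty.N (mem v0 Y.wk →ᶠ leX X.wk v0 v0)

/-- The suborder of `X` on `Y` is discrete: every element except for the first one (if there is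
one) has an immediate predecessor, and every element except for the last one (if there is one) has
an immediate successor. -/
def discrete (X Y : Term V Ty.one) : Formula V :=
  all Ty.N (mem v0 Y.wk →ᶠ
    (ex Ty.N (ltY X.wk.wk Y.wk.wk v0 v1) →ᶠ
      ex Ty.N (ltY X.wk.wk Y.wk.wk v0 v1 ∧ᶠ
        all Ty.N (ltY X.wk.wk.wk Y.wk.wk.wk v0 v2 →ᶠ leY X.wk.wk.wk Y.wk.wk.wk v0 v1)))
    ∧ᶠ (ex Ty.N (ltY X.wk.wk Y.wk.wk v1 v0) →ᶠ
      ex Ty.N (ltY X.wk.wk Y.wk.wk v1 v0 ∧ᶠ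
        all Ty.N (ltY X.wk.wk.wk Y.wk.wk.wk v2 v0 →ᶠ leY X.wk.wk.wk Y.wk.wk.wk v1 v0))))

/-- Every element of the suborder of `X` on `Y` has finitely many predecessors or finitely many
successors (a set of numbers is finite if it is bounded by a number). -/
def finitelyManyPredOrSucc (X Y : Term V Ty.one) : Formula V :=
  all Ty.N (mem v0 Y.wk →ᶠ
    ex Ty.N (all Ty.N (ltY X.wk.wk.wk Y.wk.wk.wk v0 v2 →ᶠ le v0 v1))
    ∨ᶠ ex Ty.N (all Ty.N (ltY X.wk.wk.wk Y.wk.wk.wk v2 v0 →ᶠ le v0 v1)))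

/-- `Y` is a stable suborder of `X`: a suborder that is infinite (and hence has more than one
element), is discrete, and all of whose elements have finitely many predecessors or finitely many
successors. -/
def stableSuborder (X Y : Term V Ty.one) : Formula V :=
  suborder X Y ∧ᶠ infinite Y ∧ᶠ discrete X Y ∧ᶠ finitelyManyPredOrSucc X Y

/-- `W` is a witness to stability: for each `y ∈ Y`, either `y ≤_Y w → w ≤_Y W(y)` for all `w`, or
`y ≥_Y v → v ≥_Y W(y)` for all `v`. -/
def stabilityWitness (X Y W : Term V Ty.one) : Formula V :=
  all Ty.N (mem v0 Y.wk →ᶠ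
    all Ty.N (leY X.wk.wk Y.wk.wk v1 v0 →ᶠ leY X.wk.wk Y.wk.wk v0 (W.wk.wk ⬝ v1))
    ∨ᶠ all Ty.N (leY X.wk.wk Y.wk.wk v0 v1 →ᶠ leY X.wk.wk Y.wk.wk (W.wk.wk ⬝ v1) v0))

/-- The matrix of `UCADS`, for the functional `Φ^{1 → (1 × 1)}` with components `Φ₁` and `Φ₂`:
for each infinite linear order `X`, the set `Φ₁(X)` is a stable suborder of `X`, and `Φ₂(X)`
witnesses this. -/
def isUCADS (Φ₁ Φ₂ : Term V (Ty.one ⇒ Ty.one)) : Formula V :=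
  all Ty.one (LOinf v0 →ᶠ
    stableSuborder v0 (Φ₁.wk ⬝ v0) ∧ᶠ stabilityWitness v0 (Φ₁.wk ⬝ v0) (Φ₂.wk ⬝ v0))

/-- The principle `UCADS`. -/
def UCADS : Sentence :=
  ex (Ty.one ⇒ Ty.one) (ex (Ty.one ⇒ Ty.one) (isUCADS v1 v0))

/-- The matrix of `(μ²)`: for all `f` of type `1`, if `f(n) = 0` for some `n`, then
`f(μ(f)) = 0`. -/
def isMu (m : Term V Ty.two) : Formula V :=
  all Ty.one (ex Ty.N (v1 ⬝ v0 ≐ zero) →ᶠ v0 ⬝ (m.wk ⬝ v0) ≐ zero)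

/-- The principle `(μ²)`. -/
def Mu2 : Sentence := ex Ty.two (isMu v0)

/-- `f` and `g` agree on all numbers below `k`. -/
def agreeBelow (f g : Term V Ty.one) (k : Term V Ty.N) : Formula V :=
  all Ty.N (lt v0 k.wk →ᶠ f.wk ⬝ v0 ≐ g.wk ⬝ v0)

/-- `Ξ` is an extensionality functional for `Φ = (Φ₁, Φ₂)`: if `f` and `g` agree below
`Ξ(f, g, k)`, then `Φ(f)` and `Φ(g)` agree below `k`. -/
def isExtensionalityFunctional (Ξ : Term V (Ty.one ⇒ Ty.one ⇒ Ty.N ⇒ Ty.N))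
    (Φ₁ Φ₂ : Term V (Ty.one ⇒ Ty.one)) : Formula V :=
  all Ty.one (all Ty.one (all Ty.N
    (agreeBelow v2 v1 (Ξ.wk.wk.wk ⬝ v2 ⬝ v1 ⬝ v0) →ᶠ
      agreeBelow (Φ₁.wk.wk.wk ⬝ v2) (Φ₁.wk.wk.wk ⬝ v1) v0
      ∧ᶠ agreeBelow (Φ₂.wk.wk.wk ⬝ v2) (Φ₂.wk.wk.wk ⬝ v1) v0)))

/-- `Z` witnesses that `Φ₁(X)` is infinite for each infinite linear order `X`: always
`Z(X, k) > k` and `Z(X, k) ∈ Φ₁(X)`. -/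
def isInfinityWitness (Z : Term V (Ty.one ⇒ Ty.N ⇒ Ty.N))
    (Φ₁ : Term V (Ty.one ⇒ Ty.one)) : Formula V :=
  all Ty.one (LOinf v0 →ᶠ all Ty.N
    (lt v0 (Z.wk.wk ⬝ v1 ⬝ v0) ∧ᶠ mem (Z.wk.wk ⬝ v1 ⬝ v0) (Φ₁.wk.wk ⬝ v1)))

end Principles

end HigherOrder

open HigherOrder
open HigherOrder.Term (v0 v1 v2 v3 ofClosed)
open HigherOrder.Formula (all ex)

namespace HigherOrder

open Term Formula

/-! ### Syntax: substitution in terms, formulas and axioms -/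

section Substitution

variable {U V W : Ty → Type}

/-! Derivability is reduced to truth. By a Henkin completeness theorem, `provableInRCA_of_sat`, a
sentence that holds in every extensional model of the axioms is derivable. The models are term
models of complete Henkin theories, with terms identified when the theory proves them extensionally
equal. All four claims are then proved inside an arbitrary model. Its numbers may be nonstandard, so
induction and minimization apply only to predicates given by quantifier-free formulas or by terms;
hence the supply of terms computing truth values.

From `μ` to `UCADS` (`isUCADS_of_isMu`): `μ` decides whether infinitely many elements of `X` have
finitely many successors. If so, below each of these there is another one. If not, all elements
beyond some number have infinitely many successors, and above each element of this kind there is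
another one. Either way there is a set without a last element in the chosen direction. Its records,
the elements that come after all numerically smaller members, form an infinite set on which `≤_X` is
the natural order or its reverse (`records`). Such a set is stable, and its least number is a
stability witness for every element (`isStable_of_monotone`).

From `UCADS` to `μ` (`isMu_of_isUCADS`): let `X_f` be the order on the numbers in which those from
the first zero of `f` on are moved in front of the others. Without a zero this is the natural order
`X₀`. Fix `y₀ < y₁` in `Φ₁(X₀)`. In `X₀` the witness at `y₀` must bound from below, so it is at most
`y₀`. If all zeros of `f` are large, extensionality carries `y₀`, `y₁` and this witness over to
`X_f`. If there is a zero at all, the same number fails in `X_f`: it is not above the successor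
`y₁`, and not below the infinitely many elements moved to the front. So a zero, if any, occurs below
a bound computed from `Ξ`, and bounded search finds it.

An extensionality functional comes from `QF-AC^{1,0}`, since its matrix has only bounded number
quantifiers (`exists_isExtensionality`); `Z` comes from `μ`. -/

theorem Term.subst_subst (σ : ∀ τ, U τ → Term V τ) (θ : ∀ τ, V τ → Term W τ) {τ : Ty}
    (t : Term U τ) : (t.subst σ).subst θ = t.subst fun τ x => (σ τ x).subst θ := by
  induction t with
  | var x => rfl
  | const c => rfl
  | app s t hs ht => simp only [Term.subst, hs, ht]

theorem Term.subst_var {τ : Ty} (t : Term V τ) : (t.subst fun _ x => var x) = t := by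
  induction t with
  | var x => rfl
  | const c => rfl
  | app s t hs ht => simp only [Term.subst, hs, ht]

theorem Term.wk_subst {ρ τ : Ty} (t : Term V τ) (θ : ∀ τ, Ext V ρ τ → Term W τ) :
    t.wk.subst θ = t.subst fun τ x => θ τ (Ext.old x) :=
  t.subst_subst _ _

theorem Term.subst_wk {ρ τ : Ty} (t : Term V τ) (σ : ∀ τ, V τ → Term W τ) :
    (t.subst σ).wk (ρ := ρ) = t.subst fun τ x => (σ τ x).wk :=
  t.subst_subst _ _

theorem Term.wk_subst_liftSubst {ρ τ : Ty} (t : Term V τ) (σ : ∀ τ, V τ → Term W τ) :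
    t.wk.subst (liftSubst (ρ := ρ) σ) = (t.subst σ).wk := by
  rw [Term.wk_subst, Term.subst_wk]; rfl

theorem liftSubst_comp {ρ : Ty} (σ : ∀ τ, U τ → Term V τ) (θ : ∀ τ, V τ → Term W τ) :
    (fun τ x => (liftSubst (ρ := ρ) σ τ x).subst (liftSubst θ)) =
      liftSubst fun τ x => (σ τ x).subst θ := by
  funext τ x
  cases x with
  | new => rfl
  | old x => exact Term.wk_subst_liftSubst _ _

theorem liftSubst_var {ρ : Ty} :
    (liftSubst (ρ := ρ) fun τ (x : V τ) => var x) = fun _ x => var x := by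
  funext τ x
  cases x <;> rfl

theorem Formula.subst_subst : ∀ {U V W : Ty → Type} (σ : ∀ τ, U τ → Term V τ)
    (θ : ∀ τ, V τ → Term W τ) (φ : Formula U),
    (φ.subst σ).subst θ = φ.subst fun τ x => (σ τ x).subst θ
  | _, _, _, σ, θ, .eq s t => by simp only [Formula.subst, Term.subst_subst]
  | _, _, _, _, _, .bot => rfl
  | _, _, _, σ, θ, .imp φ ψ => by
    simp only [Formula.subst, Formula.subst_subst σ θ φ, Formula.subst_subst σ θ ψ]
  | _, _, _, σ, θ, .all τ φ => by
    simp only [Formula.subst, Formula.subst_subst _ _ φ, liftSubst_comp]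

theorem Formula.subst_var : ∀ {V : Ty → Type} (φ : Formula V), (φ.subst fun _ x => var x) = φ
  | _, .eq s t => by simp only [Formula.subst, Term.subst_var]
  | _, .bot => rfl
  | _, .imp φ ψ => by simp only [Formula.subst, Formula.subst_var φ, Formula.subst_var ψ]
  | _, .all τ φ => by simp only [Formula.subst, liftSubst_var, Formula.subst_var φ]

theorem Formula.wk_subst_liftSubst {ρ : Ty} (φ : Formula V) (σ : ∀ τ, V τ → Term W τ) :
    φ.wk.subst (liftSubst (ρ := ρ) σ) = (φ.subst σ).wk := by
  rw [Formula.wk, Formula.wk, Formula.subst_subst, Formula.subst_subst]; rfl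

/-- The substitution `σ`, extended by `t` for the newest variable. -/
def consSubst {ρ : Ty} (σ : ∀ τ, V τ → Term W τ) (t : Term W ρ) : ∀ τ, Ext V ρ τ → Term W τ
  | _, Ext.new => t
  | _, Ext.old x => σ _ x

theorem Formula.subst_liftSubst_inst {ρ : Ty} (φ : Formula (Ext V ρ))
    (σ : ∀ τ, V τ → Term W τ) (t : Term W ρ) :
    (φ.subst (liftSubst σ)).inst t = φ.subst (consSubst σ t) := by
  rw [Formula.inst, Formula.subst_subst]
  congr 1
  funext τ x
  cases x with
  | new => rfl
  | old x =>
    refine (Term.wk_subst _ _).trans ?_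
    exact Term.subst_var _

theorem Formula.inst_subst {ρ : Ty} (φ : Formula (Ext V ρ)) (σ : ∀ τ, V τ → Term W τ)
    (t : Term V ρ) : (φ.inst t).subst σ = (φ.subst (liftSubst σ)).inst (t.subst σ) := by
  rw [Formula.subst_liftSubst_inst, Formula.inst, Formula.subst_subst]
  congr 1
  funext τ x
  cases x <;> rfl

theorem eqT_subst : ∀ {V W : Ty → Type} (σ : ∀ τ, V τ → Term W τ) (τ : Ty) (s t : Term V τ),
    (eqT τ s t).subst σ = eqT τ (s.subst σ) (t.subst σ)
  | _, _, _, .N, _, _ => rfl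
  | _, _, σ, .arrow ρ τ, s, t => by
    simp only [eqT, Formula.subst]
    rw [eqT_subst _ τ]
    simp only [Term.subst, Term.wk_subst_liftSubst, liftSubst]

theorem Formula.QF.subst {φ : Formula V} (h : QF φ) (σ : ∀ τ, V τ → Term W τ) :
    QF (φ.subst σ) := by
  induction h with
  | eq s t => exact QF.eq _ _
  | bot => exact QF.bot
  | imp _ _ h₁ h₂ => exact QF.imp h₁ h₂

theorem Formula.subst_succSubst (φ : Formula (Ext V Ty.N)) (σ : ∀ τ, V τ → Term W τ) :
    (φ.subst succSubst).subst (liftSubst σ) = (φ.subst (liftSubst σ)).subst succSubst := by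
  rw [Formula.subst_subst, Formula.subst_subst]
  congr 1
  funext τ x
  cases x with
  | new => rfl
  | old x => exact (Term.wk_subst (σ _ x) succSubst).symm

theorem Formula.subst_choiceSubst (φ : Formula (Ext (Ext V Ty.one) Ty.N))
    (σ : ∀ τ, V τ → Term W τ) :
    (φ.subst choiceSubst).subst (liftSubst (liftSubst σ)) =
      (φ.subst (liftSubst (liftSubst σ))).subst choiceSubst := by
  rw [Formula.subst_subst, Formula.subst_subst]
  congr 1
  funext τ x
  cases x with
  | new => rfl
  | old x =>
    cases x with
    | new => rfl
    | old x =>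
      simp only [Term.subst, choiceSubst, liftSubst, Term.wk, Term.subst_subst]

/-- The axioms are schemes in arbitrary terms. Only induction and choice, which substitute under
binders, need that these substitutions commute with `σ`. -/
theorem Axiom.subst {φ : Formula V} (h : Axiom φ) (σ : ∀ τ, V τ → Term W τ) :
    Axiom (φ.subst σ) := by
  cases h with
  | refl t => exact .refl _
  | symm s t => exact .symm _ _
  | trans r s t => exact .trans _ _ _
  | succ_ne_zero t => exact .succ_ne_zero _
  | succ_inj s t => exact .succ_inj _ _
  | K_eq x y => rw [eqT_subst]; exact .K_eq _ _
  | S_eq x y z => rw [eqT_subst]; exact .S_eq _ _ _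
  | R_zero y z => exact .R_zero _ _
  | R_succ x y z => exact .R_succ _ _ _
  | extensionality z x y =>
    rw [Formula.subst, eqT_subst, eqT_subst]
    exact .extensionality _ _ _
  | induction φ h =>
    simp only [Formula.subst, Formula.inst_subst, Formula.subst_succSubst]
    exact .induction _ (h.subst _)
  | choice φ h =>
    simp only [Formula.subst, Formula.ex, Formula.not, Formula.subst_choiceSubst]
    exact .choice _ (h.subst _)

end Substitution

/-! ### Weakening and substitution in derivations -/

section Derivations

variable {V W : Ty → Type}

theorem Derives.mono {Γ : Set (Formula V)} {φ : Formula V} (h : Derives Γ φ) :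
    ∀ {Δ : Set (Formula V)}, Γ ⊆ Δ → Derives Δ φ := by
  induction h with
  | hyp h => exact fun hs => .hyp (hs h)
  | ax h => exact fun _ => .ax h
  | impI _ ih => exact fun hs => .impI (ih (Set.insert_subset_insert hs))
  | impE _ _ ih₁ ih₂ => exact fun hs => .impE (ih₁ hs) (ih₂ hs)
  | raa _ ih => exact fun hs => .raa (ih (Set.insert_subset_insert hs))
  | allI _ ih => exact fun hs => .allI (ih (Set.image_mono hs))
  | allE t _ ih => exact fun hs => .allE t (ih hs)

/-- Substitution may change the family of variables. This replaces constants in the Henkin argument: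
a fresh variable can be turned into a bound one, and free variables can be closed off. -/
theorem Derives.subst {Γ : Set (Formula V)} {φ : Formula V} (h : Derives Γ φ) :
    ∀ {W : Ty → Type} (σ : ∀ τ, V τ → Term W τ),
      Derives (Formula.subst σ '' Γ) (φ.subst σ) := by
  induction h with
  | hyp h => exact fun σ => .hyp (Set.mem_image_of_mem _ h)
  | ax h => exact fun σ => .ax (h.subst σ)
  | impI _ ih =>
    intro W σ
    have := ih σ
    rw [Set.image_insert_eq] at this
    exact .impI this
  | impE _ _ ih₁ ih₂ => exact fun σ => .impE (ih₁ σ) (ih₂ σ)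
  | raa _ ih =>
    intro W σ
    have := ih σ
    rw [Set.image_insert_eq] at this
    exact .raa this
  | allI _ ih =>
    intro W σ
    have := ih (liftSubst σ)
    refine .allI ?_
    convert this using 1
    simp only [Set.image_image, Formula.wk_subst_liftSubst]
  | allE t _ ih =>
    intro W σ
    rw [Formula.inst_subst]
    exact .allE _ (ih σ)

theorem Derives.exFalso {Γ : Set (Formula V)} {φ : Formula V} (h : Derives Γ bot) :
    Derives Γ φ :=
  .raa (h.mono (Set.subset_insert _ _))

theorem Derives.imp_of_not {Γ : Set (Formula V)} {φ ψ : Formula V}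
    (h : Derives Γ (Formula.not φ)) : Derives Γ (φ →ᶠ ψ) :=
  .impI (.exFalso (.impE (h.mono (Set.subset_insert _ _)) (.hyp (Set.mem_insert _ _))))

theorem Derives.imp_of_right {Γ : Set (Formula V)} {φ ψ : Formula V}
    (h : Derives Γ ψ) : Derives Γ (φ →ᶠ ψ) :=
  .impI (h.mono (Set.subset_insert _ _))

end Derivations

/-! ### Countability of the language -/

section Countability

/-- The nesting depth of a type. -/
def Ty.depth : Ty → ℕ
  | .N => 0
  | .arrow ρ τ => max ρ.depth τ.depth + 1

instance : Countable Ty := by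
  have h : ∀ n, {τ : Ty | τ.depth < n}.Countable := by
    intro n
    induction n with
    | zero => simp
    | succ n ih =>
      refine ((Set.countable_singleton Ty.N).union (ih.image2 ih Ty.arrow)).mono ?_
      rintro (_ | ⟨ρ, τ⟩) hτ
      · exact Or.inl rfl
      · simp only [Ty.depth, Set.mem_ofPred_eq] at hτ
        exact Or.inr ⟨ρ, by simp only [Set.mem_ofPred_eq]; omega, τ,
          by simp only [Set.mem_ofPred_eq]; omega, rfl⟩
  refine Set.countable_univ_iff.1 ((Set.countable_iUnion h).mono fun τ _ => ?_)
  exact Set.mem_iUnion.2 ⟨τ.depth + 1, Nat.lt_succ_self _⟩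

instance (τ : Ty) : Countable (Const τ) := by
  let f : Const τ → Option (Option (Option (Ty × Ty ⊕ Ty × Ty × Ty)))
    | .zero => none
    | .succ => some none
    | .R => some (some none)
    | .K ρ τ => some (some (some (.inl (ρ, τ))))
    | .S δ ρ τ => some (some (some (.inr (δ, ρ, τ))))
  refine Function.Injective.countable (f := f) ?_
  intro c d h
  cases c <;> cases d <;> simp_all [f]

instance {V : Ty → Type} [∀ τ, Countable (V τ)] (ρ τ : Ty) : Countable (Ext V ρ τ) := by
  let f : Ext V ρ τ → Option (V τ)
    | .new => none
    | .old x => some x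
  refine Function.Injective.countable (f := f) ?_
  intro c d h
  cases c <;> cases d <;> simp_all [f]

variable {V : Ty → Type}

/-- The depth of a term. -/
def Term.depth : ∀ {τ : Ty}, Term V τ → ℕ
  | _, .var _ => 0
  | _, .const _ => 0
  | _, .app s t => max s.depth t.depth + 1

instance [∀ τ, Countable (V τ)] (τ : Ty) : Countable (Term V τ) := by
  have h : ∀ n τ, {t : Term V τ | t.depth < n}.Countable := by
    intro n
    induction n with
    | zero => simp
    | succ n ih =>
      intro τ
      refine (((Set.countable_range (Term.var (V := V) (τ := τ))).union
        (Set.countable_range Term.const)).union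
        (Set.countable_iUnion fun ρ => (ih (ρ ⇒ τ)).image2 (ih ρ) Term.app)).mono ?_
      rintro t ht
      cases t with
      | var x => exact Or.inl (Or.inl ⟨x, rfl⟩)
      | const c => exact Or.inl (Or.inr ⟨c, rfl⟩)
      | app s t =>
        simp only [Term.depth, Set.mem_ofPred_eq] at ht
        exact Or.inr (Set.mem_iUnion.2 ⟨_, s, by simp only [Set.mem_ofPred_eq]; omega, t,
          by simp only [Set.mem_ofPred_eq]; omega, rfl⟩)
  refine Set.countable_univ_iff.1 ((Set.countable_iUnion fun n => h n τ).mono fun t _ => ?_)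
  exact Set.mem_iUnion.2 ⟨t.depth + 1, Nat.lt_succ_self _⟩

/-- The depth of a formula. -/
def Formula.depth : ∀ {V : Ty → Type}, Formula V → ℕ
  | _, .eq _ _ => 0
  | _, .bot => 0
  | _, .imp φ ψ => max φ.depth ψ.depth + 1
  | _, .all _ φ => φ.depth + 1

/-- The induction on depth is uniform in the family of variables, because passing under a quantifier
changes that family. -/
instance [∀ τ, Countable (V τ)] : Countable (Formula V) := by
  have h : ∀ n (V : Ty → Type) [∀ τ, Countable (V τ)],
      {φ : Formula V | φ.depth < n}.Countable := by
    intro n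
    induction n with
    | zero => simp
    | succ n ih =>
      intro V _
      refine ((((Set.countable_range fun p : Term V Ty.N × Term V Ty.N =>
        Formula.eq p.1 p.2).union (Set.countable_singleton Formula.bot)).union
        ((ih V).image2 (ih V) Formula.imp)).union
        (Set.countable_iUnion fun τ => (ih (Ext V τ)).image (Formula.all τ))).mono ?_
      rintro φ hφ
      cases φ with
      | eq s t => exact Or.inl (Or.inl (Or.inl ⟨(s, t), rfl⟩))
      | bot => exact Or.inl (Or.inl (Or.inr rfl))
      | imp φ ψ =>
        simp only [Formula.depth, Set.mem_ofPred_eq] at hφ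
        exact Or.inl (Or.inr ⟨φ, by simp only [Set.mem_ofPred_eq]; omega, ψ,
          by simp only [Set.mem_ofPred_eq]; omega, rfl⟩)
      | all τ φ =>
        simp only [Formula.depth, Set.mem_ofPred_eq] at hφ
        exact Or.inr (Set.mem_iUnion.2 ⟨τ, φ, by simp only [Set.mem_ofPred_eq]; omega, rfl⟩)
  refine Set.countable_univ_iff.1 ((Set.countable_iUnion fun n => h n V).mono fun φ _ => ?_)
  exact Set.mem_iUnion.2 ⟨φ.depth + 1, Nat.lt_succ_self _⟩

end Countability

/-! ### Finite support of terms and formulas -/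

section Support

/-- Only the variables of rank less than `n` matter for substitutions into `t`. -/
theorem Term.exists_support {V : Ty → Type} (r : ∀ τ, V τ → ℕ) {τ : Ty} (t : Term V τ) :
    ∃ n, ∀ (W : Ty → Type) (σ θ : ∀ τ, V τ → Term W τ),
      (∀ τ x, r τ x < n → σ τ x = θ τ x) → t.subst σ = t.subst θ := by
  induction t with
  | var x => exact ⟨r _ x + 1, fun W σ θ h => h _ x (Nat.lt_succ_self _)⟩
  | const c => exact ⟨0, fun W σ θ h => rfl⟩
  | app s t hs ht =>
    obtain ⟨n, hn⟩ := hs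
    obtain ⟨m, hm⟩ := ht
    refine ⟨max n m, fun W σ θ h => ?_⟩
    rw [Term.subst, Term.subst, hn W σ θ fun τ x hx => h τ x (by omega),
      hm W σ θ fun τ x hx => h τ x (by omega)]

/-- Ranks of variables, extended by `0` for the newest one. -/
def extRank {V : Ty → Type} {ρ : Ty} (r : ∀ τ, V τ → ℕ) : ∀ τ, Ext V ρ τ → ℕ
  | _, Ext.new => 0
  | _, Ext.old x => r _ x

theorem Formula.exists_support : ∀ {V : Ty → Type} (r : ∀ τ, V τ → ℕ) (φ : Formula V),
    ∃ n, ∀ (W : Ty → Type) (σ θ : ∀ τ, V τ → Term W τ),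
      (∀ τ x, r τ x < n → σ τ x = θ τ x) → φ.subst σ = φ.subst θ
  | _, r, .eq s t => by
    obtain ⟨n, hn⟩ := s.exists_support r
    obtain ⟨m, hm⟩ := t.exists_support r
    refine ⟨max n m, fun W σ θ h => ?_⟩
    rw [Formula.subst, Formula.subst, hn W σ θ fun τ x hx => h τ x (by omega),
      hm W σ θ fun τ x hx => h τ x (by omega)]
  | _, _, .bot => ⟨0, fun _ _ _ _ => rfl⟩
  | _, r, .imp φ ψ => by
    obtain ⟨n, hn⟩ := φ.exists_support r
    obtain ⟨m, hm⟩ := ψ.exists_support r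
    refine ⟨max n m, fun W σ θ h => ?_⟩
    rw [Formula.subst, Formula.subst, hn W σ θ fun τ x hx => h τ x (by omega),
      hm W σ θ fun τ x hx => h τ x (by omega)]
  | _, r, .all ρ φ => by
    obtain ⟨n, hn⟩ := φ.exists_support (extRank r)
    refine ⟨n, fun W σ θ h => ?_⟩
    rw [Formula.subst, Formula.subst]
    congr 1
    refine hn _ _ _ fun τ x hx => ?_
    cases x with
    | new => rfl
    | old x => simp only [liftSubst, h _ x hx]

end Support

/-! ### Models -/

section Semantics

/-- An applicative structure for the language. -/
structure Model where
  D : Ty → Type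
  app : ∀ {ρ τ : Ty}, D (ρ ⇒ τ) → D ρ → D τ
  con : ∀ {τ : Ty}, Const τ → D τ

/-- The environment `e`, extended by `a` for the newest variable. -/
def consEnv {V D : Ty → Type} {ρ : Ty} (e : ∀ τ, V τ → D τ) (a : D ρ) : ∀ τ, Ext V ρ τ → D τ
  | _, Ext.new => a
  | _, Ext.old x => e _ x

namespace Model

/-- The value of a term. -/
def eval (M : Model) {V : Ty → Type} (e : ∀ τ, V τ → M.D τ) : ∀ {τ : Ty}, Term V τ → M.D τ
  | _, .var x => e _ x
  | _, .const c => M.con c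
  | _, .app s t => M.app (M.eval e s) (M.eval e t)

/-- The truth of a formula. -/
def sat (M : Model) : ∀ {V : Ty → Type}, (∀ τ, V τ → M.D τ) → Formula V → Prop
  | _, e, .eq s t => M.eval e s = M.eval e t
  | _, _, .bot => False
  | _, e, .imp φ ψ => M.sat e φ → M.sat e ψ
  | _, e, .all τ φ => ∀ a : M.D τ, M.sat (consEnv e a) φ

/-- Extensional models of `RCA₀^ω`. -/
structure IsRCA (M : Model) : Prop where
  ext : ∀ {ρ τ : Ty} (f g : M.D (ρ ⇒ τ)), (∀ x, M.app f x = M.app g x) → f = g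
  valid : ∀ {V : Ty → Type} {φ : Formula V}, Axiom φ → ∀ e, M.sat e φ

end Model

end Semantics

/-! ### Henkin completeness -/

section Henkin

/-- Countably many variables of each type. -/
abbrev NatVar : Ty → Type := fun _ => ℕ

/-- Consistent sets of formulas all of whose variables have an index below some number. -/
structure IsStage (Γ : Set (Formula NatVar)) : Prop where
  consistent : ¬ Derives Γ bot
  support : ∃ n, ∀ φ ∈ Γ, ∀ (W : Ty → Type) (σ θ : ∀ τ, NatVar τ → Term W τ),
    (∀ τ x, x < n → σ τ x = θ τ x) → φ.subst σ = φ.subst θ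

theorem IsStage.insert {Γ : Set (Formula NatVar)} (h : IsStage Γ) {φ : Formula NatVar}
    (hφ : ¬ Derives (insert φ Γ) bot) : IsStage (insert φ Γ) := by
  refine ⟨hφ, ?_⟩
  obtain ⟨n, hn⟩ := h.support
  obtain ⟨m, hm⟩ := φ.exists_support fun _ x => x
  refine ⟨max n m, ?_⟩
  rintro ψ (rfl | hψ) W σ θ hσ
  · exact hm W σ θ fun τ x hx => hσ τ x (by omega)
  · exact hn ψ hψ W σ θ fun τ x hx => hσ τ x (by omega)

/-- The substitution of the newest variable for the variable of type `ρ` and index `n`. -/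
noncomputable def generalize (ρ : Ty) (n : ℕ) (τ : Ty) (x : NatVar τ) : Term (Ext NatVar ρ) τ := by
  classical exact if h : τ = ρ ∧ x = n then h.1 ▸ v0 else var (Ext.old x)

theorem generalize_self (ρ : Ty) (n : ℕ) : generalize ρ n ρ n = v0 := by
  simp [generalize]

theorem generalize_of_lt (ρ : Ty) (n : ℕ) (τ : Ty) (x : NatVar τ) (h : x < n) :
    generalize ρ n τ x = var (Ext.old x) := by
  have : ¬ (τ = ρ ∧ x = n) := fun h' => absurd h'.2 (Nat.ne_of_lt h)
  simp [generalize, this]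

/-- A variable `c` beyond the supports of `Γ` and `φ` is fresh. If `¬φ(c)` were refutable from `Γ`,
then generalizing `c` would derive `∀ φ`, whose negation is in `Γ`. -/
theorem IsStage.exists_witness {Γ : Set (Formula NatVar)} (h : IsStage Γ) {ρ : Ty}
    {φ : Formula (Ext NatVar ρ)} (hφ : Formula.not (all ρ φ) ∈ Γ) :
    ∃ c : ℕ, IsStage (Insert.insert (Formula.not (φ.inst (var c))) Γ) := by
  obtain ⟨n, hn⟩ := h.support
  obtain ⟨m, hm⟩ := φ.exists_support (extRank fun _ x => x)
  refine ⟨max n m, h.insert fun hd => h.consistent (.impE (.hyp hφ) (.allI ?_))⟩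
  have := hd.raa.subst (generalize ρ (max n m))
  rw [Formula.inst_subst, Formula.subst_liftSubst_inst] at this
  convert this using 1
  · refine Set.image_congr fun ψ hψ => ?_
    refine hn ψ hψ _ _ _ fun τ x hx => ?_
    rw [generalize_of_lt _ _ _ _ (lt_of_lt_of_le hx (le_max_left _ _))]
  · refine (φ.subst_var).symm.trans (hm _ _ _ fun τ x hx => ?_)
    cases x with
    | new => exact (generalize_self _ _).symm
    | old x => exact (generalize_of_lt _ _ _ _ (lt_of_lt_of_le hx (le_max_right _ _))).symm

/-- One Lindenbaum step: `φ` is decided, and a rejected universal formula receives a counterexample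
at once. -/
theorem IsStage.exists_next {Γ : Set (Formula NatVar)} (h : IsStage Γ) (φ : Formula NatVar) :
    ∃ Δ, IsStage Δ ∧ Γ ⊆ Δ ∧ (φ ∈ Δ ∨ Formula.not φ ∈ Δ) ∧
      ∀ ρ ψ, φ = all ρ ψ → φ ∈ Δ ∨ ∃ c : ℕ, Formula.not (ψ.inst (var c)) ∈ Δ := by
  by_cases hφ : Derives (Insert.insert φ Γ) bot
  · have h' : IsStage (Insert.insert (Formula.not φ) Γ) :=
      h.insert fun hd => h.consistent (.impE hφ.impI hd.raa)
    by_cases hall : ∃ ρ ψ, φ = all ρ ψ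
    · obtain ⟨ρ, ψ, rfl⟩ := hall
      obtain ⟨c, hc⟩ := h'.exists_witness (Set.mem_insert _ _)
      refine ⟨_, hc, fun χ hχ => Or.inr (Or.inr hχ), Or.inr (Or.inr (Or.inl rfl)), ?_⟩
      rintro ρ' ψ' ⟨⟩
      exact Or.inr ⟨c, Or.inl rfl⟩
    · exact ⟨_, h', Set.subset_insert _ _, Or.inr (Set.mem_insert _ _),
        fun ρ ψ hψ => absurd ⟨ρ, ψ, hψ⟩ hall⟩
  · exact ⟨_, h.insert hφ, Set.subset_insert _ _, Or.inl (Set.mem_insert _ _),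
      fun _ _ _ => Or.inl (Set.mem_insert _ _)⟩

/-- A complete Henkin theory. -/
structure IsHenkin (T : Set (Formula NatVar)) : Prop where
  ax : ∀ {φ}, Axiom φ → φ ∈ T
  bot : bot ∉ T
  imp : ∀ {φ ψ}, (φ →ᶠ ψ) ∈ T ↔ (φ ∈ T → ψ ∈ T)
  all : ∀ {ρ} {φ : Formula (Ext NatVar ρ)}, all ρ φ ∈ T ↔ ∀ t, φ.inst t ∈ T

theorem IsStage.exists_henkin {Γ : Set (Formula NatVar)} (h : IsStage Γ) :
    ∃ T, IsHenkin T ∧ Γ ⊆ T := by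
  classical
  have : Nonempty (Formula NatVar) := ⟨Formula.bot⟩
  obtain ⟨f, hf⟩ := exists_surjective_nat (Formula NatVar)
  choose next hnext hsub hdec hwit using fun (Δ : {Δ // IsStage Δ}) φ => Δ.2.exists_next φ
  let G : ℕ → {Δ // IsStage Δ} := fun n =>
    Nat.rec ⟨Γ, h⟩ (fun n Δ => ⟨next Δ (f n), hnext Δ (f n)⟩) n
  have hG : ∀ n, (G n).1 ⊆ (G (n + 1)).1 := fun n => hsub (G n) (f n)
  have hmono : Monotone fun n => (G n).1 := monotone_nat_of_le_succ hG
  -- Taking what some stage derives, rather than the union of the stages, gives the axioms and modus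
  -- ponens without a compactness argument.
  let T : Set (Formula NatVar) := {φ | ∃ n, Derives (G n).1 φ}
  have hmem : ∀ {φ n}, φ ∈ (G n).1 → φ ∈ T := fun h => ⟨_, .hyp h⟩
  have hmp : ∀ {φ ψ}, (φ →ᶠ ψ) ∈ T → φ ∈ T → ψ ∈ T := by
    rintro φ ψ ⟨n, hn⟩ ⟨m, hm⟩
    exact ⟨max n m, .impE (hn.mono (hmono (le_max_left _ _)))
      (hm.mono (hmono (le_max_right _ _)))⟩
  have hbot : Formula.bot ∉ T := fun ⟨n, hn⟩ => (G n).2.consistent hn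
  have hcompl : ∀ φ, φ ∈ T ∨ Formula.not φ ∈ T := by
    intro φ
    obtain ⟨n, rfl⟩ := hf φ
    exact (hdec (G n) (f n)).imp (fun h => hmem (n := n + 1) h) fun h => hmem (n := n + 1) h
  refine ⟨T, ⟨fun ha => ⟨0, .ax ha⟩, hbot, ⟨hmp, fun hi => ?_⟩, ⟨?_, fun ha => ?_⟩⟩,
    fun φ hφ => hmem (n := 0) hφ⟩
  · rename_i φ ψ
    rcases hcompl φ with hφ | ⟨n, hn⟩
    · obtain ⟨n, hn⟩ := hi hφ
      exact ⟨n, hn.imp_of_right⟩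
    · exact ⟨n, hn.imp_of_not⟩
  · rintro ⟨n, hn⟩ t
    exact ⟨n, hn.allE t⟩
  · rename_i ρ φ
    obtain ⟨n, hn⟩ := hf (Formula.all ρ φ)
    rcases hwit (G n) (f n) ρ φ hn with h | ⟨c, hc⟩
    · exact hn ▸ hmem (n := n + 1) h
    · exact absurd (hmp (hmem (n := n + 1) hc) (ha (var c))) hbot

namespace IsHenkin

variable {T : Set (Formula NatVar)}

theorem eqT_refl (h : IsHenkin T) : ∀ (τ : Ty) (s : Term NatVar τ), eqT τ s s ∈ T
  | .N, s => h.ax (.refl s)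
  | .arrow _ τ, _ => by
    refine h.all.2 fun t => ?_
    rw [Formula.inst, eqT_subst]
    exact h.eqT_refl τ _

/-- This is where the Henkin property enters: a universal formula is in `T` as soon as all its
instances are, so equality in `T` is pointwise equality on terms. Hence the quotient is extensional.
-/
theorem eqT_arrow (h : IsHenkin T) {ρ τ : Ty} {s t : Term NatVar (ρ ⇒ τ)} :
    eqT (ρ ⇒ τ) s t ∈ T ↔ ∀ r, eqT τ (s ⬝ r) (t ⬝ r) ∈ T := by
  refine h.all.trans (forall_congr' fun r => ?_)
  rw [Formula.inst, eqT_subst]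
  have : ∀ s : Term NatVar (ρ ⇒ τ), (s.wk ⬝ v0).subst (instSubst r) = s ⬝ r := by
    intro s
    simp only [Term.subst, Term.wk_subst, instSubst, Term.subst_var]
  rw [this, this]

theorem eqT_symm (h : IsHenkin T) : ∀ (τ : Ty) {s t : Term NatVar τ},
    eqT τ s t ∈ T → eqT τ t s ∈ T
  | .N, s, t, hst => h.imp.1 (h.ax (.symm s t)) hst
  | .arrow _ τ, _, _, hst =>
    h.eqT_arrow.2 fun r => h.eqT_symm τ (h.eqT_arrow.1 hst r)

theorem eqT_trans (h : IsHenkin T) : ∀ (τ : Ty) {r s t : Term NatVar τ},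
    eqT τ r s ∈ T → eqT τ s t ∈ T → eqT τ r t ∈ T
  | .N, r, s, t, hrs, hst => h.imp.1 (h.imp.1 (h.ax (.trans r s t)) hrs) hst
  | .arrow _ τ, _, _, _, hrs, hst =>
    h.eqT_arrow.2 fun r => h.eqT_trans τ (h.eqT_arrow.1 hrs r) (h.eqT_arrow.1 hst r)

/-- Provable equality in a Henkin theory. -/
def setoid (h : IsHenkin T) (τ : Ty) : Setoid (Term NatVar τ) where
  r s t := eqT τ s t ∈ T
  iseqv := ⟨h.eqT_refl τ, h.eqT_symm τ, h.eqT_trans τ⟩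

/-- The term model of a Henkin theory. -/
def model (h : IsHenkin T) : Model where
  D τ := Quotient (h.setoid τ)
  -- Well defined: changing the function is covered by pointwise equality, changing the argument by
  -- the axiom of extensionality.
  app := fun {_ τ} => Quotient.map₂ Term.app fun _ s' hs t t' ht =>
    h.eqT_trans τ (h.eqT_arrow.1 hs t) (h.imp.1 (h.ax (.extensionality s' t t')) ht)
  con := fun c => Quotient.mk _ (const c)

variable {V : Ty → Type}

/-- The environment of the term model given by a substitution. -/
def env (h : IsHenkin T) (σ : ∀ τ, V τ → Term NatVar τ) (τ : Ty) (x : V τ) : h.model.D τ :=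
  Quotient.mk (h.setoid τ) (σ τ x)

theorem eval_model (h : IsHenkin T) (σ : ∀ τ, V τ → Term NatVar τ) {τ : Ty} (t : Term V τ) :
    h.model.eval (h.env σ) t = Quotient.mk (h.setoid τ) (t.subst σ) := by
  induction t with
  | var x => rfl
  | const c => rfl
  | app s t hs ht => rw [Model.eval, hs, ht]; rfl

theorem consEnv_env (h : IsHenkin T) (σ : ∀ τ, V τ → Term NatVar τ) {ρ : Ty}
    (t : Term NatVar ρ) :
    consEnv (h.env σ) (Quotient.mk (h.setoid ρ) t : h.model.D ρ) = h.env (consSubst σ t) := by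
  funext τ x
  cases x <;> rfl

/-- The truth lemma. The quantifier case works because every element of the model is the class of a
term. -/
theorem sat_model (h : IsHenkin T) : ∀ {V : Ty → Type} (φ : Formula V)
    (σ : ∀ τ, V τ → Term NatVar τ), h.model.sat (h.env σ) φ ↔ φ.subst σ ∈ T
  | _, .eq s t, σ => by
    rw [Model.sat, h.eval_model, h.eval_model]
    exact Quotient.eq
  | _, .bot, σ => iff_of_false id h.bot
  | _, .imp φ ψ, σ => by
    rw [Model.sat, h.sat_model φ, h.sat_model ψ, Formula.subst, h.imp]
  | _, .all ρ φ, σ => by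
    rw [Model.sat, Formula.subst, h.all]
    refine ⟨fun hs t => ?_, fun hs a => ?_⟩
    · have := hs (Quotient.mk (h.setoid ρ) t)
      rwa [h.consEnv_env, h.sat_model φ, ← Formula.subst_liftSubst_inst] at this
    · induction a using Quotient.ind with
      | _ t =>
        rw [h.consEnv_env, h.sat_model φ, ← Formula.subst_liftSubst_inst]
        exact hs t

theorem exists_env (h : IsHenkin T) (e : ∀ τ, V τ → h.model.D τ) : ∃ σ, e = h.env σ :=
  ⟨fun τ x => (e τ x).out, by funext τ x; exact (Quotient.out_eq _).symm⟩

theorem isRCA_model (h : IsHenkin T) : h.model.IsRCA := by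
  refine ⟨fun {ρ τ} f g => ?_, fun {V φ} ha e => ?_⟩
  · induction f using Quotient.ind with
    | _ s =>
      induction g using Quotient.ind with
      | _ t =>
        intro hst
        exact Quotient.sound (h.eqT_arrow.2 fun r =>
          Quotient.exact (hst (Quotient.mk (h.setoid ρ) r)))
  · obtain ⟨σ, rfl⟩ := h.exists_env e
    exact (h.sat_model φ σ).2 (h.ax (ha.subst σ))

end IsHenkin

/-- A closed term of each type. -/
def someClosedTerm : ∀ τ : Ty, ClosedTerm τ
  | .N => zero
  | .arrow _ τ => K ⬝ someClosedTerm τ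

/-- Completeness: what holds in all extensional models is provable. -/
theorem provableInRCA_of_sat {φ : Sentence}
    (h : ∀ M : Model, M.IsRCA → ∀ e : ∀ τ, NoVar τ → M.D τ, M.sat e φ) : ProvableInRCA φ := by
  by_contra hφ
  let ι : ∀ τ, NoVar τ → Term NatVar τ := fun _ x => nomatch x
  have hstage : IsStage {(Formula.not φ).subst ι} := by
    refine ⟨fun hd => hφ ?_, ?_⟩
    -- Closed terms for all variables turn a derivation over `NatVar` into one over no variables.
    · have := hd.subst fun τ _ => someClosedTerm τ
      rw [Set.image_singleton, Formula.subst_subst] at this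
      have hid : (Formula.not φ).subst (fun τ x => (ι τ x).subst fun τ _ => someClosedTerm τ) =
          Formula.not φ := by
        refine Eq.trans ?_ (Formula.subst_var _)
        congr 1
        funext τ x
        exact nomatch x
      rw [hid] at this
      exact .raa (this.mono (by simp))
    · obtain ⟨n, hn⟩ := ((Formula.not φ).subst ι).exists_support fun _ x => x
      exact ⟨n, by rintro ψ rfl; exact hn⟩
  obtain ⟨T, hT, hsub⟩ := hstage.exists_henkin
  have hnot := (hT.sat_model (Formula.not φ) ι).2 (hsub rfl)
  exact hnot (h _ hT.isRCA_model _)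

end Henkin

/-! ### Evaluation of terms and formulas -/

namespace Model

variable {M : Model} {V W : Ty → Type}

instance {ρ τ : Ty} : CoeFun (M.D (ρ ⇒ τ)) fun _ => M.D ρ → M.D τ := ⟨M.app⟩

@[simp] theorem eval_var (e : ∀ τ, V τ → M.D τ) {τ : Ty} (x : V τ) :
    M.eval e (var x) = e τ x := rfl

@[simp] theorem eval_const (e : ∀ τ, V τ → M.D τ) {τ : Ty} (c : Const τ) :
    M.eval e (const c) = M.con c := rfl

@[simp] theorem eval_app (e : ∀ τ, V τ → M.D τ) {ρ τ : Ty} (s : Term V (ρ ⇒ τ))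
    (t : Term V ρ) : M.eval e (s ⬝ t) = M.eval e s (M.eval e t) := rfl

@[simp] theorem consEnv_new {ρ : Ty} (e : ∀ τ, V τ → M.D τ) (a : M.D ρ) :
    consEnv e a ρ Ext.new = a := rfl

@[simp] theorem consEnv_old {ρ τ : Ty} (e : ∀ τ, V τ → M.D τ) (a : M.D ρ) (x : V τ) :
    consEnv e a τ (Ext.old x) = e τ x := rfl

theorem eval_subst (e : ∀ τ, W τ → M.D τ) (σ : ∀ τ, V τ → Term W τ) {τ : Ty} (t : Term V τ) :
    M.eval e (t.subst σ) = M.eval (fun τ x => M.eval e (σ τ x)) t := by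
  induction t with
  | var x => rfl
  | const c => rfl
  | app s t hs ht => simp only [Term.subst, eval_app, hs, ht]

@[simp] theorem eval_wk (e : ∀ τ, V τ → M.D τ) {ρ τ : Ty} (a : M.D ρ) (t : Term V τ) :
    M.eval (consEnv e a) t.wk = M.eval e t :=
  M.eval_subst _ _ t

theorem sat_subst : ∀ {V W : Ty → Type} (e : ∀ τ, W τ → M.D τ) (σ : ∀ τ, V τ → Term W τ)
    (φ : Formula V), M.sat e (φ.subst σ) ↔ M.sat (fun τ x => M.eval e (σ τ x)) φ
  | _, _, e, σ, .eq s t => by simp only [Formula.subst, sat, eval_subst]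
  | _, _, _, _, .bot => Iff.rfl
  | _, _, e, σ, .imp φ ψ => by
    simp only [Formula.subst, sat, sat_subst e σ φ, sat_subst e σ ψ]
  | _, _, e, σ, .all τ φ => by
    refine forall_congr' fun a => ?_
    rw [sat_subst _ _ φ]
    have : (fun τ' x => M.eval (consEnv e a) (liftSubst σ τ' x)) =
        consEnv (fun τ x => M.eval e (σ τ x)) a := by
      funext τ' x
      cases x with
      | new => rfl
      | old x => exact M.eval_wk _ _ _
    rw [this]

section Connectives

variable (e : ∀ τ, V τ → M.D τ) (φ ψ : Formula V)

@[simp] theorem sat_eq (s t : Term V Ty.N) : M.sat e (s ≐ t) ↔ M.eval e s = M.eval e t := Iff.rfl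

@[simp] theorem sat_bot : M.sat e Formula.bot ↔ False := Iff.rfl

@[simp] theorem sat_imp : M.sat e (φ →ᶠ ψ) ↔ (M.sat e φ → M.sat e ψ) := Iff.rfl

@[simp] theorem sat_all {τ : Ty} (φ : Formula (Ext V τ)) :
    M.sat e (Formula.all τ φ) ↔ ∀ a, M.sat (consEnv e a) φ := Iff.rfl

@[simp] theorem sat_not : M.sat e (Formula.not φ) ↔ ¬ M.sat e φ := Iff.rfl

@[simp] theorem sat_and : M.sat e (φ ∧ᶠ ψ) ↔ M.sat e φ ∧ M.sat e ψ := by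
  simp [Formula.and]

@[simp] theorem sat_or : M.sat e (φ ∨ᶠ ψ) ↔ M.sat e φ ∨ M.sat e ψ := by
  simp only [Formula.or, sat_imp, sat_not]; tauto

@[simp] theorem sat_iff : M.sat e (φ ↔ᶠ ψ) ↔ (M.sat e φ ↔ M.sat e ψ) := by
  simp only [Formula.iff, sat_and, sat_imp]; tauto

@[simp] theorem sat_ex {τ : Ty} (φ : Formula (Ext V τ)) :
    M.sat e (Formula.ex τ φ) ↔ ∃ a, M.sat (consEnv e a) φ := by
  simp [Formula.ex]

end Connectives

/-- The empty environment. -/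
def noEnv (M : Model) : ∀ τ, NoVar τ → M.D τ := fun _ x => nomatch x

/-- The value of a closed term. -/
def val (M : Model) {τ : Ty} (t : ClosedTerm τ) : M.D τ := M.eval M.noEnv t

@[simp] theorem eval_ofClosed (e : ∀ τ, V τ → M.D τ) {τ : Ty} (t : ClosedTerm τ) :
    M.eval e (ofClosed t) = M.val t := by
  rw [ofClosed, eval_subst]
  unfold val
  congr 1
  funext τ x
  exact nomatch x

/-- The environment in which the elements of the model are names of themselves. -/
abbrev self (M : Model) : ∀ τ, M.D τ → M.D τ := fun _ x => x

end Model

/-- The extensional models of `RCA₀^ω`. -/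
structure RCAModel extends Model where
  isRCA : toModel.IsRCA

/-! ### Combinators, recursion and induction in a model -/

namespace RCAModel

open Model

variable {M : RCAModel} {V : Ty → Type}

/-- The numbers of a model. -/
abbrev Num (M : RCAModel) : Type := M.D Ty.N

theorem ext {ρ τ : Ty} {f g : M.D (ρ ⇒ τ)} (h : ∀ x, f x = g x) : f = g :=
  M.isRCA.ext f g h

@[simp] theorem sat_eqT : ∀ {V : Ty → Type} (e : ∀ τ, V τ → M.D τ) (τ : Ty) (s t : Term V τ),
    M.sat e (eqT τ s t) ↔ M.eval e s = M.eval e t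
  | _, _, .N, _, _ => Iff.rfl
  | _, e, .arrow ρ τ, s, t => by
    simp only [eqT, sat_all, sat_eqT _ τ, eval_app, eval_wk, eval_var, consEnv_new]
    exact ⟨ext, fun h _ => by rw [h]⟩

-- The elements of the model serve as variables naming themselves, so an axiom about variables
-- becomes an identity for all elements.
@[simp] theorem K_app {ρ τ : Ty} (x : M.D ρ) (y : M.D τ) :
    (M.con (Const.K ρ τ) : M.D (ρ ⇒ τ ⇒ ρ)) x y = x :=
  (sat_eqT _ _ _ _).1 (M.isRCA.valid (.K_eq (var x) (var y)) M.self)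

@[simp] theorem S_app {δ ρ τ : Ty} (x : M.D (δ ⇒ ρ ⇒ τ)) (y : M.D (δ ⇒ ρ)) (z : M.D δ) :
    (M.con (Const.S δ ρ τ) : M.D ((δ ⇒ ρ ⇒ τ) ⇒ (δ ⇒ ρ) ⇒ δ ⇒ τ)) x y z = x z (y z) :=
  (sat_eqT _ _ _ _).1 (M.isRCA.valid (.S_eq (var x) (var y) (var z)) M.self)

@[simp] theorem eval_lam (e : ∀ τ, V τ → M.D τ) {ρ τ : Ty} (t : Term (Ext V ρ) τ) (a : M.D ρ) :
    M.eval e (lam t) a = M.eval (consEnv e a) t := by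
  induction t with
  | var x => cases x <;> simp [lam]
  | const c => simp [lam]
  | app s t hs ht => simp only [lam, eval_app, eval_const, S_app, hs, ht]

@[simp] theorem val_lam {ρ τ : Ty} (t : Term (Ext NoVar ρ) τ) (a : M.D ρ) :
    M.val (lam t) a = M.eval (consEnv M.noEnv a) t :=
  eval_lam _ _ _

instance : Zero M.Num := ⟨M.con Const.zero⟩

/-- The successor function of a model. -/
def succ (x : M.Num) : M.Num := (M.con Const.succ : M.D Ty.one) x

/-- Primitive recursion in a model. -/
def natRec (x y : M.Num) (z : M.D (Ty.N ⇒ Ty.N ⇒ Ty.N)) : M.Num := M.con Const.R x y z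

@[simp] theorem con_zero : M.con Const.zero = (0 : M.Num) := rfl

theorem succ_ne_zero (x : M.Num) : succ x ≠ 0 :=
  M.isRCA.valid (.succ_ne_zero (var x)) M.self

theorem succ_inj {x y : M.Num} : succ x = succ y ↔ x = y :=
  ⟨M.isRCA.valid (.succ_inj (var x) (var y)) M.self, fun h => h ▸ rfl⟩

theorem natRec_zero (y : M.Num) (z : M.D (Ty.N ⇒ Ty.N ⇒ Ty.N)) : natRec 0 y z = y :=
  M.isRCA.valid (.R_zero (var y) (var z)) M.self

theorem natRec_succ (x y : M.Num) (z : M.D (Ty.N ⇒ Ty.N ⇒ Ty.N)) :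
    natRec (succ x) y z = z (natRec x y z) x :=
  M.isRCA.valid (.R_succ (var x) (var y) (var z)) M.self

/-- Functions on the numbers of a model that are given by an element of the model. -/
def Definable (F : M.Num → M.Num) : Prop := ∃ f : M.D Ty.one, ∀ n, f n = F n

namespace Definable

theorem of_term (t : Term (Ext M.D Ty.N) Ty.N) :
    Definable fun n => M.eval (consEnv M.self n) t :=
  ⟨M.eval M.self (lam t), fun _ => eval_lam _ _ _⟩

theorem id : Definable fun n : M.Num => n := of_term v0

theorem const (a : M.Num) : Definable fun _ : M.Num => a := of_term (var (Ext.old a))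

theorem comp {F : M.Num → M.Num} (hF : Definable F) (g : M.D Ty.one) :
    Definable fun n => g (F n) := by
  obtain ⟨f, hf⟩ := hF
  simpa [hf] using of_term (M := M) (var (Ext.old g) ⬝ (var (Ext.old f) ⬝ v0))

theorem comp₂ {F G : M.Num → M.Num} (hF : Definable F) (hG : Definable G)
    (g : M.D (Ty.N ⇒ Ty.one)) : Definable fun n => g (F n) (G n) := by
  obtain ⟨f, hf⟩ := hF
  obtain ⟨f', hf'⟩ := hG
  simpa [hf, hf'] using of_term (M := M)
    (var (Ext.old g) ⬝ (var (Ext.old f) ⬝ v0) ⬝ (var (Ext.old f') ⬝ v0))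

theorem succ {F : M.Num → M.Num} (hF : Definable F) : Definable fun n => succ (F n) :=
  hF.comp (M.con Const.succ)

end Definable

/-- Predicates on the numbers of a model that are given by a quantifier-free formula. -/
def QFPred (P : M.Num → Prop) : Prop :=
  ∃ φ : Formula (Ext M.D Ty.N), QF φ ∧ ∀ n, M.sat (consEnv M.self n) φ ↔ P n

namespace QFPred

theorem eq {F G : M.Num → M.Num} (hF : Definable F) (hG : Definable G) :
    QFPred fun n => F n = G n := by
  obtain ⟨f, hf⟩ := hF
  obtain ⟨g, hg⟩ := hG
  exact ⟨_, QF.eq (var (Ext.old f) ⬝ v0) (var (Ext.old g) ⬝ v0), fun n => by simp [hf, hg]⟩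

theorem imp {P Q : M.Num → Prop} (hP : QFPred P) (hQ : QFPred Q) :
    QFPred fun n => P n → Q n := by
  obtain ⟨φ, hφ, hφ'⟩ := hP
  obtain ⟨ψ, hψ, hψ'⟩ := hQ
  exact ⟨_, hφ.imp hψ, fun n => by simp [hφ', hψ']⟩

theorem not {P : M.Num → Prop} (hP : QFPred P) : QFPred fun n => ¬ P n := by
  obtain ⟨φ, hφ, hφ'⟩ := hP
  exact ⟨_, hφ.imp QF.bot, fun n => by simp [hφ']⟩

theorem or {P Q : M.Num → Prop} (hP : QFPred P) (hQ : QFPred Q) :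
    QFPred fun n => P n ∨ Q n := by
  simpa only [← or_iff_not_imp_left] using hP.not.imp hQ

theorem and {P Q : M.Num → Prop} (hP : QFPred P) (hQ : QFPred Q) :
    QFPred fun n => P n ∧ Q n := by
  simpa only [Classical.not_imp, Classical.not_not] using (hP.imp hQ.not).not

theorem induction {P : M.Num → Prop} (hP : QFPred P) (h0 : P 0)
    (hs : ∀ n, P n → P (RCAModel.succ n)) (n : M.Num) : P n := by
  obtain ⟨φ, hφ, hφ'⟩ := hP
  have h := M.isRCA.valid (Axiom.induction φ hφ) M.self
  simp only [sat_imp, sat_all, hφ', Formula.inst, sat_subst] at h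
  refine h ?_ (fun n hn => ?_) n
  · rw [← hφ'] at h0
    convert h0 using 1
    funext τ x
    cases x <;> rfl
  · have hn' := hs n hn
    rw [← hφ'] at hn'
    convert hn' using 1
    funext τ x
    cases x <;> rfl

end QFPred

/-- Equality of two definable functions is quantifier-free, so the algebraic identities below fall
under the available induction. -/
theorem eq_of_recursion {F G : M.Num → M.Num} (hF : Definable F) (hG : Definable G)
    (h0 : F 0 = G 0) (hs : ∀ n, F n = G n → F (succ n) = G (succ n)) (n : M.Num) : F n = G n :=
  (QFPred.eq hF hG).induction h0 hs n

instance : One M.Num := ⟨succ 0⟩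

instance : Add M.Num := ⟨fun x y => M.eval M.self (Term.add (var x) (var y))⟩

instance : Mul M.Num := ⟨fun x y => M.eval M.self (Term.mul (var x) (var y))⟩

theorem add_def (x y : M.Num) :
    x + y = natRec y x (M.eval M.self (lam (lam (Term.succ v1)))) := rfl

theorem mul_def (x y : M.Num) :
    x * y = natRec y 0 (M.eval M.self (lam (lam (Term.add v1 (var x).wk.wk)))) := rfl

@[simp] theorem eval_zero (e : ∀ τ, V τ → M.D τ) : M.eval e zero = (0 : M.Num) := rfl

@[simp] theorem eval_add (e : ∀ τ, V τ → M.D τ) (s t : Term V Ty.N) :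
    M.eval e (add s t) = M.eval e s + M.eval e t := rfl

@[simp] theorem eval_mul (e : ∀ τ, V τ → M.D τ) (s t : Term V Ty.N) :
    M.eval e (mul s t) = M.eval e s * M.eval e t := by
  -- The recursion step of `mul` contains the left factor, so the two step functionals come from
  -- different terms; extensionality identifies them.
  refine congrArg (natRec _ _) (ext fun x => ext fun y => ?_)
  simp

/-! ### The numbers of a model as a commutative semiring -/

section Arithmetic

variable (x y z : M.Num)

theorem add_zero' : x + 0 = x := natRec_zero _ _

theorem add_succ : x + succ y = succ (x + y) := by
  rw [add_def, natRec_succ, ← add_def]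
  simp [succ]

theorem succ_eq : succ x = x + 1 := by
  show _ = x + succ 0
  rw [add_succ, add_zero']

theorem mul_zero' : x * 0 = 0 := natRec_zero _ _

theorem mul_succ : x * succ y = x * y + x := by
  rw [mul_def, natRec_succ, ← mul_def]
  simp

theorem Definable.add {F G : M.Num → M.Num} (hF : Definable F) (hG : Definable G) :
    Definable fun n => F n + G n := by
  simpa using hF.comp₂ hG (M.eval M.self (lam (lam (Term.add v1 v0))))

theorem Definable.mul {F G : M.Num → M.Num} (hF : Definable F) (hG : Definable G) :
    Definable fun n => F n * G n := by
  simpa using hF.comp₂ hG (M.eval M.self (lam (lam (Term.mul v1 v0))))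

theorem zero_add' : 0 + x = x :=
  eq_of_recursion ((Definable.const 0).add .id) .id (add_zero' 0)
    (fun n hn => by rw [add_succ, hn]) x

theorem succ_add : succ x + y = succ (x + y) :=
  eq_of_recursion ((Definable.const _).add .id) ((Definable.const _).add .id).succ
    (by rw [add_zero', add_zero']) (fun n hn => by rw [add_succ, hn, add_succ]) y

theorem add_comm' : x + y = y + x :=
  eq_of_recursion ((Definable.const _).add .id) (Definable.id.add (.const _))
    (by rw [add_zero', zero_add']) (fun n hn => by rw [add_succ, hn, succ_add]) y

theorem add_assoc' : x + y + z = x + (y + z) :=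
  eq_of_recursion ((Definable.const _).add .id) ((Definable.const _).add ((Definable.const _).add .id))
    (by rw [add_zero', add_zero']) (fun n hn => by rw [add_succ, hn, add_succ, add_succ]) z

instance : AddCommMonoid M.Num where
  add_assoc := add_assoc'
  zero_add := zero_add'
  add_zero := add_zero'
  add_comm := add_comm'
  nsmul := nsmulRec

theorem zero_mul' : 0 * x = 0 :=
  eq_of_recursion ((Definable.const _).mul .id) (.const _) (mul_zero' 0)
    (fun n hn => by rw [mul_succ, hn, add_zero]) x

theorem succ_mul : succ x * y = x * y + y :=
  eq_of_recursion ((Definable.const _).mul .id) (((Definable.const _).mul .id).add .id)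
    (by simp only [mul_zero', add_zero])
    (fun n hn => by rw [mul_succ, hn, mul_succ, add_succ, add_succ, add_right_comm]) y

theorem mul_comm' : x * y = y * x :=
  eq_of_recursion ((Definable.const _).mul .id) (Definable.id.mul (.const _))
    (by rw [mul_zero', zero_mul']) (fun n hn => by rw [mul_succ, hn, succ_mul]) y

theorem mul_add' : x * (y + z) = x * y + x * z :=
  eq_of_recursion ((Definable.const _).mul ((Definable.const _).add .id))
    ((Definable.const _).add ((Definable.const _).mul .id))
    (by simp only [mul_zero', add_zero])
    (fun n hn => by rw [add_succ, mul_succ, hn, mul_succ, add_assoc]) z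

theorem mul_assoc' : x * y * z = x * (y * z) :=
  eq_of_recursion ((Definable.const _).mul .id)
    ((Definable.const _).mul ((Definable.const _).mul .id))
    (by simp only [mul_zero'])
    (fun n hn => by rw [mul_succ, hn, mul_succ, mul_add']) z

instance : CommSemiring M.Num where
  left_distrib := mul_add'
  right_distrib x y z := by rw [mul_comm', mul_add', mul_comm' z, mul_comm' z]
  zero_mul := zero_mul'
  mul_zero := mul_zero'
  mul_assoc := mul_assoc'
  one_mul x := by
    rw [mul_comm']
    show x * succ 0 = x
    rw [mul_succ, mul_zero', zero_add]
  mul_one x := by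
    show x * succ 0 = x
    rw [mul_succ, mul_zero', zero_add]
  mul_comm := mul_comm'
  nsmul := nsmulRec
  npow := npowRec

@[simp] theorem con_succ : (M.con Const.succ : M.D Ty.one) x = x + 1 := succ_eq x

theorem induction {P : M.Num → Prop} (hP : QFPred P) (h0 : P 0)
    (hs : ∀ n, P n → P (n + 1)) (n : M.Num) : P n :=
  hP.induction h0 (fun n hn => succ_eq n ▸ hs n hn) n

theorem natRec_add_one (y : M.Num) (w : M.D (Ty.N ⇒ Ty.N ⇒ Ty.N)) :
    natRec (x + 1) y w = w (natRec x y w) x := by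
  rw [← succ_eq, natRec_succ]

theorem add_one_ne_zero : x + 1 ≠ 0 := succ_eq x ▸ succ_ne_zero x

theorem add_one_inj {x y : M.Num} : x + 1 = y + 1 ↔ x = y := by
  rw [← succ_eq, ← succ_eq, succ_inj]

end Arithmetic

end RCAModel

/-! ### Terms for case distinction, bounded search and truth values -/

namespace Term

variable {V : Ty → Type}

/-- The numeral `1`. -/
abbrev one : Term V Ty.N := succ zero

/-- The predecessor function. -/
def predC : ClosedTerm Ty.one := lam (R ⬝ v0 ⬝ zero ⬝ lam (lam v0))

/-- Truncated subtraction. -/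
def monusC : ClosedTerm (Ty.N ⇒ Ty.one) :=
  lam (lam (R ⬝ v0 ⬝ v1 ⬝ ofClosed (lam (lam (ofClosed predC ⬝ v1)))))

/-- Case distinction: `iteC ⬝ c ⬝ x ⬝ y` is `y` if `c` is zero, and `x` otherwise. -/
def iteC : ClosedTerm (Ty.N ⇒ Ty.N ⇒ Ty.one) :=
  lam (lam (lam (R ⬝ v2 ⬝ v0 ⬝ lam (lam v3))))

/-- The recursion step of bounded search. -/
def searchStepC : ClosedTerm (Ty.one ⇒ Ty.N ⇒ Ty.one) :=
  lam (lam (lam (ofClosed iteC ⬝ (v2 ⬝ v1) ⬝ v1 ⬝ succ v0)))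

/-- Bounded search: the least `i < n` with `f i ≠ 0`, and `n` if there is none. -/
def leastC : ClosedTerm (Ty.one ⇒ Ty.one) :=
  lam (lam (R ⬝ v0 ⬝ zero ⬝ (ofClosed searchStepC ⬝ v1)))

def monus (s t : Term V Ty.N) : Term V Ty.N := ofClosed monusC ⬝ s ⬝ t

def iteT (c s t : Term V Ty.N) : Term V Ty.N := ofClosed iteC ⬝ c ⬝ s ⬝ t

/-- The least `i` below `n` with `t(i) ≠ 0`, and `n` if there is none. -/
def least (n : Term V Ty.N) (t : Term (Ext V Ty.N) Ty.N) : Term V Ty.N :=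
  ofClosed leastC ⬝ lam t ⬝ n

/-- Truth values of negations. -/
def notT (s : Term V Ty.N) : Term V Ty.N := monus one s

/-- Truth values of disjunctions. -/
def orT (s t : Term V Ty.N) : Term V Ty.N := notT (notT (add s t))

/-- Truth values of conjunctions. -/
def andT (s t : Term V Ty.N) : Term V Ty.N := notT (orT (notT s) (notT t))

/-- Truth values of implications. -/
def impT (s t : Term V Ty.N) : Term V Ty.N := orT (notT s) t

/-- The truth value of `s ≤ t`. -/
def leT (s t : Term V Ty.N) : Term V Ty.N := notT (monus s t)

/-- The truth value of `s < t`. -/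
def ltT (s t : Term V Ty.N) : Term V Ty.N := notT (leT t s)

/-- The truth value of `s = t`. -/
def eqN (s t : Term V Ty.N) : Term V Ty.N := andT (leT s t) (leT t s)

/-- Truth values of bounded existential quantifications. -/
def bexT (n : Term V Ty.N) (t : Term (Ext V Ty.N) Ty.N) : Term V Ty.N := ltT (least n t) n

/-- Truth values of bounded universal quantifications. -/
def ballT (n : Term V Ty.N) (t : Term (Ext V Ty.N) Ty.N) : Term V Ty.N :=
  notT (bexT n (notT t))

/-- Truth values of existential quantifications, by means of `μ`. -/
def exT (m : Term V Ty.two) (t : Term (Ext V Ty.N) Ty.N) : Term V Ty.N :=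
  notT (lam (notT t) ⬝ (m ⬝ lam (notT t)))

/-- Truth values of universal quantifications, by means of `μ`. -/
def allT (m : Term V Ty.two) (t : Term (Ext V Ty.N) Ty.N) : Term V Ty.N :=
  notT (exT m (notT t))

end Term

namespace RCAModel

open Model

variable {M : RCAModel} {V : Ty → Type}

@[simp] theorem con_R (x y : M.Num) (z : M.D (Ty.N ⇒ Ty.N ⇒ Ty.N)) :
    (M.con Const.R : M.D (Ty.N ⇒ Ty.N ⇒ (Ty.N ⇒ Ty.N ⇒ Ty.N) ⇒ Ty.N)) x y z = natRec x y z :=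
  rfl

instance : Sub M.Num := ⟨fun x y => M.val monusC x y⟩

@[simp] theorem eval_monus (e : ∀ τ, V τ → M.D τ) (s t : Term V Ty.N) :
    M.eval e (monus s t) = M.eval e s - M.eval e t := by
  simp only [monus, eval_app, eval_ofClosed]; rfl

/-! ### Truncated subtraction and the order of the numbers -/

section Subtraction

variable (x y z : M.Num)

/-- The predecessor function of a model. -/
def pred (x : M.Num) : M.Num := M.val predC x

theorem pred_zero : pred (0 : M.Num) = 0 := by
  simp [pred, predC, natRec_zero]

theorem pred_add_one : pred (x + 1) = x := by
  simp [pred, predC, natRec_add_one]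

theorem sub_def : x - y = natRec y x (M.val (lam (lam (ofClosed predC ⬝ v1)))) := by
  show M.val monusC x y = _
  simp [monusC]

theorem sub_zero' : x - 0 = x := by rw [sub_def, natRec_zero]

theorem sub_add_one : x - (y + 1) = pred (x - y) := by
  rw [sub_def, natRec_add_one, ← sub_def]
  simp [pred]

theorem Definable.sub {F G : M.Num → M.Num} (hF : Definable F) (hG : Definable G) :
    Definable fun n => F n - G n :=
  hF.comp₂ hG (M.val monusC)

theorem Definable.pred {F : M.Num → M.Num} (hF : Definable F) :
    Definable fun n => pred (F n) :=
  hF.comp (M.val predC)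

theorem eq_zero_or_eq_add_one : x = 0 ∨ ∃ y, x = y + 1 := by
  -- The predecessor replaces the existential quantifier, to make the induction quantifier-free.
  have : x = 0 ∨ x = pred x + 1 := induction (P := fun x => x = 0 ∨ x = pred x + 1)
    (QFPred.or (.eq .id (.const _)) (.eq .id (Definable.id.pred.add (.const _))))
    (Or.inl rfl) (fun n _ => Or.inr (by rw [pred_add_one])) x
  exact this.imp_right fun h => ⟨_, h⟩

theorem add_one_sub_add_one : x + 1 - (y + 1) = x - y := by
  refine induction (P := fun y => x + 1 - (y + 1) = x - y)
    (.eq ((Definable.const _).sub (Definable.id.add (.const _))) ((Definable.const _).sub .id))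
    ?_ (fun n hn => ?_) y
  · rw [sub_add_one, sub_zero', sub_zero', pred_add_one]
  · rw [sub_add_one, hn, sub_add_one]

theorem add_sub_cancel_left' : x + y - x = y := by
  refine induction (P := fun x => x + y - x = y)
    (.eq ((Definable.id.add (.const _)).sub .id) (.const _)) ?_ (fun n hn => ?_) x
  · rw [sub_zero', zero_add]
  · rw [add_right_comm, add_one_sub_add_one, hn]

theorem add_left_cancel' {x y z : M.Num} (h : x + y = x + z) : y = z := by
  rw [← add_sub_cancel_left' x y, h, add_sub_cancel_left']

/-- Totality of `≤` in quantifier-free form: the differences are given by terms, so induction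
applies. -/
theorem sub_total : y + (x - y) = x ∨ x + (y - x) = y := by
  refine induction (P := fun y => y + (x - y) = x ∨ x + (y - x) = y)
    (.or (.eq (Definable.id.add ((Definable.const _).sub .id)) (.const _))
      (.eq ((Definable.const _).add (Definable.id.sub (.const _))) .id))
    (Or.inl (by rw [sub_zero', zero_add])) (fun n hn => ?_) y
  rcases hn with hn | hn
  · rcases eq_zero_or_eq_add_one (x - n) with h | ⟨z, h⟩
    · rw [h, add_zero] at hn
      subst hn
      exact Or.inr (by rw [add_sub_cancel_left'])
    · refine Or.inl ?_
      rw [sub_add_one, h, pred_add_one]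
      rw [h] at hn
      rw [add_right_comm, add_assoc, hn]
  · refine Or.inr ?_
    have : n + 1 = x + (n - x + 1) := by rw [← add_assoc, hn]
    rw [this, add_sub_cancel_left']

theorem add_eq_zero' {x y : M.Num} (h : x + y = 0) : x = 0 := by
  rcases eq_zero_or_eq_add_one y with rfl | ⟨z, rfl⟩
  · rwa [add_zero] at h
  · exact absurd h (by rw [← add_assoc]; exact add_one_ne_zero _)

instance : LE M.Num := ⟨fun x y => ∃ z, x + z = y⟩

theorem le_def {x y : M.Num} : x ≤ y ↔ ∃ z, x + z = y := Iff.rfl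

noncomputable instance : LinearOrder M.Num where
  le_refl x := ⟨0, add_zero x⟩
  le_trans := by
    rintro x y z ⟨a, rfl⟩ ⟨b, rfl⟩
    exact ⟨a + b, (add_assoc _ _ _).symm⟩
  le_antisymm := by
    rintro x y ⟨a, rfl⟩ ⟨b, h⟩
    rw [add_assoc] at h
    have : a + b = 0 := add_left_cancel' (x := x) (by rw [h, add_zero])
    rw [add_eq_zero' this, add_zero]
  le_total x y := (sub_total x y).symm.imp (fun h => ⟨_, h⟩) fun h => ⟨_, h⟩
  toDecidableLE := Classical.decRel _

instance : CanonicallyOrderedAdd M.Num where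
  le_self_add x y := ⟨y, rfl⟩
  le_add_self x y := ⟨y, add_comm _ _⟩
  exists_add_of_le := by
    rintro x y ⟨z, rfl⟩
    exact ⟨z, rfl⟩

instance : IsOrderedCancelAddMonoid M.Num where
  add_le_add_left := by
    rintro x y ⟨z, rfl⟩ w
    exact ⟨z, add_right_comm _ _ _⟩
  le_of_add_le_add_left := by
    rintro x y z ⟨w, h⟩
    exact ⟨w, add_left_cancel' (by rw [← add_assoc, h])⟩

instance : IsOrderedRing M.Num where
  zero_le_one := zero_le
  mul_le_mul_of_nonneg_left := by
    rintro x - y z ⟨w, rfl⟩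
    exact ⟨x * w, (mul_add _ _ _).symm⟩
  mul_le_mul_of_nonneg_right := by
    rintro x - y z ⟨w, rfl⟩
    exact ⟨w * x, (add_mul _ _ _).symm⟩

instance : NeZero (1 : M.Num) := ⟨by simpa using add_one_ne_zero (0 : M.Num)⟩

theorem lt_add_one_iff {x y : M.Num} : x < y + 1 ↔ x ≤ y := by
  constructor
  · intro h
    obtain ⟨z, hz⟩ := h.le
    rcases eq_zero_or_eq_add_one z with rfl | ⟨w, rfl⟩
    · exact absurd (by rw [← hz, add_zero]) h.ne
    · rw [← add_assoc, add_one_inj] at hz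
      exact ⟨w, hz⟩
  · intro h
    refine lt_of_le_of_ne (h.trans ⟨1, rfl⟩) ?_
    rintro rfl
    obtain ⟨z, hz⟩ := h
    have := add_left_cancel' (x := y) (y := 1 + z) (z := 0) (by rw [← add_assoc, hz, add_zero])
    exact one_ne_zero (add_eq_zero' this)

theorem add_one_le_iff {x y : M.Num} : x + 1 ≤ y ↔ x < y := by
  rw [← not_lt, lt_add_one_iff, not_le]

/-- Makes the existentially defined `≤` an equation between terms, and thus available in inductions
and in truth values. -/
theorem sub_eq_zero_iff {x y : M.Num} : x - y = 0 ↔ x ≤ y := by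
  constructor
  · intro h
    rcases sub_total x y with h' | h'
    · rw [← h', h, add_zero]
    · exact ⟨_, h'⟩
  · rintro ⟨z, rfl⟩
    refine induction (P := fun z => x - (x + z) = 0)
      (.eq ((Definable.const _).sub ((Definable.const _).add .id)) (.const _))
      ?_ (fun n hn => ?_) z
    · simpa using add_sub_cancel_left' x 0
    · rw [← add_assoc, sub_add_one, hn, pred_zero]

end Subtraction

/-! ### Truth values computed by terms -/

section TruthValues

/-- The truth value of a proposition. -/
noncomputable def chi (p : Prop) : M.Num := by
  classical exact if p then 1 else 0

@[simp] theorem chi_eq_zero {p : Prop} : (chi p : M.Num) = 0 ↔ ¬ p := by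
  simp [chi]

@[simp] theorem chi_eq_one {p : Prop} : (chi p : M.Num) = 1 ↔ p := by
  simp [chi]

theorem chi_le_one (p : Prop) : (chi p : M.Num) ≤ 1 := by
  by_cases p <;> simp [chi, *]

theorem chi_congr {p q : Prop} (h : p ↔ q) : (chi p : M.Num) = chi q := by rw [h]

theorem one_sub (x : M.Num) : 1 - x = chi (x = 0) := by
  by_cases h : x = 0
  · simp only [h, sub_zero', chi]; simp
  · have : (1 : M.Num) ≤ x := by
      rw [← zero_add (1 : M.Num), add_one_le_iff]
      exact pos_iff_ne_zero.2 h
    simp [sub_eq_zero_iff.2 this, chi, h]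

variable (e : ∀ τ, V τ → M.D τ) (s t : Term V Ty.N)

theorem eval_one : M.eval e Term.one = (1 : M.Num) := by
  simp

@[simp] theorem eval_notT : M.eval e (notT s) = chi (M.eval e s = 0) := by
  rw [notT, eval_monus, eval_one, one_sub]

@[simp] theorem eval_orT : M.eval e (orT s t) = chi (M.eval e s ≠ 0 ∨ M.eval e t ≠ 0) := by
  rw [orT, eval_notT, eval_notT]
  refine chi_congr ?_
  rw [chi_eq_zero, eval_add, add_eq_zero, not_and_or]

@[simp] theorem eval_andT : M.eval e (andT s t) = chi (M.eval e s ≠ 0 ∧ M.eval e t ≠ 0) := by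
  rw [andT, eval_notT, eval_orT]
  refine chi_congr ?_
  simp

@[simp] theorem eval_impT : M.eval e (impT s t) = chi (M.eval e s ≠ 0 → M.eval e t ≠ 0) := by
  rw [impT, eval_orT]
  refine chi_congr ?_
  rw [eval_notT, Ne, chi_eq_zero, Classical.not_not, imp_iff_not_or, not_ne_iff]

@[simp] theorem eval_leT : M.eval e (leT s t) = chi (M.eval e s ≤ M.eval e t) := by
  rw [leT, eval_notT, eval_monus, sub_eq_zero_iff]

@[simp] theorem eval_ltT : M.eval e (ltT s t) = chi (M.eval e s < M.eval e t) := by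
  rw [ltT, eval_notT, eval_leT]
  exact chi_congr (by simp)

@[simp] theorem eval_eqN : M.eval e (eqN s t) = chi (M.eval e s = M.eval e t) := by
  rw [eqN, eval_andT, eval_leT, eval_leT]
  exact chi_congr (by rw [le_antisymm_iff (a := M.eval e s)]; simp)

theorem val_iteC (c x y : M.Num) [Decidable (c = 0)] :
    M.val iteC c x y = if c = 0 then y else x := by
  simp only [iteC, val_lam, eval_lam, eval_app, eval_const, con_R, eval_var, consEnv_new,
    consEnv_old]
  rcases eq_zero_or_eq_add_one c with rfl | ⟨d, rfl⟩
  · rw [natRec_zero, if_pos rfl]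
  · rw [natRec_add_one, if_neg (add_one_ne_zero d)]
    simp

@[simp] theorem eval_iteT (c : Term V Ty.N) [Decidable (M.eval e c = 0)] :
    M.eval e (iteT c s t) = if M.eval e c = 0 then M.eval e t else M.eval e s := by
  rw [iteT, eval_app, eval_app, eval_app, eval_ofClosed, val_iteC]

end TruthValues

end RCAModel

namespace RCAModel

open Model

variable {M : RCAModel} {V : Ty → Type}

theorem Definable.chi_le {F G : M.Num → M.Num} (hF : Definable F) (hG : Definable G) :
    Definable fun n => chi (F n ≤ G n) := by
  simpa using hF.comp₂ hG (M.eval M.self (lam (lam (leT v1 v0))))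

theorem QFPred.le {F G : M.Num → M.Num} (hF : Definable F) (hG : Definable G) :
    QFPred fun n => F n ≤ G n := by
  simpa using QFPred.eq (hF.chi_le hG) (.const 1)

theorem QFPred.lt {F G : M.Num → M.Num} (hF : Definable F) (hG : Definable G) :
    QFPred fun n => F n < G n := by
  simpa using (QFPred.le hG hF).not

/-! ### Bounded search -/

section BoundedSearch

variable (f : M.D Ty.one) (n : M.Num)

/-- The least `i < n` with `f i ≠ 0`, and `n` if there is none. -/
def search : M.Num := M.val leastC f n

theorem search_def : search f n = natRec n 0 (M.val searchStepC f) := by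
  simp [search, leastC]

theorem search_zero : search f 0 = 0 := by
  rw [search_def, natRec_zero]

theorem search_add_one [Decidable (f (search f n) = 0)] :
    search f (n + 1) = if f (search f n) = 0 then n + 1 else search f n := by
  rw [search_def, natRec_add_one, ← search_def]
  simp [searchStepC, val_iteC]

theorem Definable.search {F : M.Num → M.Num} (hF : Definable F) :
    Definable fun n => search f (F n) :=
  hF.comp (M.val leastC f)

theorem search_spec : search f n < n ∧ f (search f n) ≠ 0 ∨ search f n = n := by
  classical
  refine induction (P := fun n => search f n < n ∧ f (search f n) ≠ 0 ∨ search f n = n)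
    (.or (.and (.lt (Definable.id.search f) .id)
      (.not (.eq ((Definable.id.search f).comp f) (.const 0))))
      (.eq (Definable.id.search f) .id)) (Or.inr (search_zero f)) (fun n hn => ?_) n
  rw [search_add_one]
  by_cases h : f (search f n) = 0
  · exact Or.inr (if_pos h)
  · rw [if_neg h]
    refine Or.inl ⟨lt_add_one_iff.2 ?_, h⟩
    exact hn.elim (fun h => h.1.le) fun h => h.le

theorem search_le : search f n ≤ n :=
  (search_spec f n).elim (fun h => h.1.le) fun h => h.le

/-- Once the search has hit an argument with nonzero value, it stays there; before that, `search f n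
= n`. -/
theorem search_of_lt (i : M.Num) (hi : f i ≠ 0) :
    i < n → search f n ≤ i ∧ f (search f n) ≠ 0 := by
  classical
  refine induction (P := fun n => i < n → search f n ≤ i ∧ f (search f n) ≠ 0)
    (.imp (.lt (.const i) .id) (.and (.le (Definable.id.search f) (.const i))
      (.not (.eq ((Definable.id.search f).comp f) (.const 0)))))
    (fun h => absurd h not_lt_zero) (fun n hn hin => ?_) n
  have h : search f n ≤ i ∧ f (search f n) ≠ 0 := by
    rcases (lt_add_one_iff.1 hin).lt_or_eq with h | rfl
    · exact hn h
    · refine ⟨search_le f i, (search_spec f i).elim (fun h => h.2) fun h => h.symm ▸ hi⟩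
  rw [search_add_one, if_neg h.2]
  exact h

theorem search_lt_iff : search f n < n ↔ ∃ i, i < n ∧ f i ≠ 0 := by
  constructor
  · intro h
    exact ⟨_, h, (search_spec f n).elim (fun h => h.2) fun h' => absurd h' h.ne⟩
  · rintro ⟨i, hi, hf⟩
    exact (search_of_lt f n i hf hi).1.trans_lt hi

end BoundedSearch

section Terms

variable (e : ∀ τ, V τ → M.D τ) (n : Term V Ty.N) (t : Term (Ext V Ty.N) Ty.N)

@[simp] theorem eval_least : M.eval e (least n t) = search (M.eval e (lam t)) (M.eval e n) := by
  simp [least, search]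

@[simp] theorem eval_bexT :
    M.eval e (bexT n t) = chi (∃ i, i < M.eval e n ∧ M.eval (consEnv e i) t ≠ 0) := by
  rw [bexT, eval_ltT, eval_least, search_lt_iff]
  simp

@[simp] theorem eval_ballT :
    M.eval e (ballT n t) = chi (∀ i, i < M.eval e n → M.eval (consEnv e i) t ≠ 0) := by
  rw [ballT, eval_notT, eval_bexT]
  refine chi_congr ?_
  simp

/-- `μ` is Feferman's search operator. -/
def IsMu (m : M.D Ty.two) : Prop := ∀ f : M.D Ty.one, (∃ n, f n = 0) → f (m f) = 0

@[simp] theorem sat_isMu (m : Term V Ty.two) : M.sat e (isMu m) ↔ IsMu (M.eval e m) := by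
  simp [isMu, IsMu]

/-- `f` takes a value other than zero, according to `μ`. -/
def MuEx (m : M.D Ty.two) (f : M.D Ty.one) : Prop :=
  f (m (M.eval M.self (lam (notT ((var f).wk ⬝ v0))))) ≠ 0

/-- `μ` looks for zeros, so it is applied to the truth value of `f x = 0`, which vanishes exactly
where `f` does not. -/
theorem muEx_iff {m : M.D Ty.two} (hm : IsMu m) (f : M.D Ty.one) :
    MuEx m f ↔ ∃ i, f i ≠ 0 := by
  refine ⟨fun h => ⟨_, h⟩, fun h => ?_⟩
  have := hm (M.eval M.self (lam (notT ((var f).wk ⬝ v0)))) (by simpa using h)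
  simpa [MuEx] using this

@[simp] theorem eval_exT (m : Term V Ty.two) :
    M.eval e (exT m t) = chi (MuEx (M.eval e m) (M.eval e (lam t))) := by
  have : M.eval e (lam (notT t)) =
      M.eval M.self (lam (notT ((var (M.eval e (lam t))).wk ⬝ v0))) := ext fun x => by simp
  rw [exT, eval_notT, eval_app, eval_app, MuEx, ← this]
  refine chi_congr ?_
  simp

@[simp] theorem eval_allT (m : Term V Ty.two) :
    M.eval e (allT m t) = chi (¬ MuEx (M.eval e m) (M.eval e (lam (notT t)))) := by
  rw [allT, eval_notT, eval_exT, chi_eq_zero]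

end Terms

/-! ### Least and greatest elements of definable sets -/

section Extrema

variable {P : M.Num → Prop}

theorem exists_min {f : M.D Ty.one} (hf : ∀ n, f n ≠ 0 ↔ P n) {a : M.Num} (ha : P a) :
    ∃ m, P m ∧ ∀ k, P k → m ≤ k := by
  have h := fun i hi => search_of_lt f (a + 1) i ((hf i).2 hi)
  refine ⟨search f (a + 1), (hf _).1 (h a ha (lt_add_one_iff.2 le_rfl)).2, fun k hk => ?_⟩
  rcases le_total k a with hka | hka
  · exact (h k hk (lt_add_one_iff.2 hka)).1
  · exact (h a ha (lt_add_one_iff.2 le_rfl)).1.trans hka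

theorem exists_max {f : M.D Ty.one} (hf : ∀ n, f n ≠ 0 ↔ P n) {a b : M.Num} (ha : P a)
    (hb : ∀ k, P k → k ≤ b) : ∃ m, P m ∧ ∀ k, P k → k ≤ m := by
  -- As `b` bounds `P`, being an upper bound of `P` needs only a bounded quantifier. The least upper
  -- bound is then attained, or its predecessor would also be one.
  let g : M.D Ty.one := M.eval M.self (lam (ballT (add (var b).wk one)
    (impT ((var f).wk.wk ⬝ v0) (leT v0 v1))))
  have hg : ∀ u, g u ≠ 0 ↔ ∀ k, P k → k ≤ u := by
    intro u
    simp only [g, eval_lam, eval_ballT, eval_add, eval_impT, eval_app, eval_wk, eval_var, hf,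
      eval_leT, consEnv_new, consEnv_old, Ne, chi_eq_zero, Classical.not_not]
    exact ⟨fun h k hk => h k (lt_add_one_iff.2 (hb k hk)) hk, fun h k _ => h k⟩
  obtain ⟨m, hm, hmin⟩ := exists_min hg hb
  refine ⟨m, ?_, hm⟩
  by_contra hPm
  rcases eq_zero_or_eq_add_one m with rfl | ⟨v, rfl⟩
  · exact hPm (le_antisymm (hm a ha) zero_le ▸ ha)
  · have : v + 1 ≤ v := hmin v fun k hk => by
      refine lt_add_one_iff.1 (lt_of_le_of_ne (hm k hk) ?_)
      rintro rfl
      exact hPm hk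
    exact absurd (add_one_le_iff.1 this) (lt_irrefl _)

end Extrema

/-! ### Injectivity of the pairing function -/

section Coding

/-- The code of a pair of numbers. -/
def pairing (x y : M.Num) : M.Num := (x + y) * (x + y) + x

@[simp] theorem eval_pair (e : ∀ τ, V τ → M.D τ) (s t : Term V Ty.N) :
    M.eval e (pair s t) = pairing (M.eval e s) (M.eval e t) := by
  simp [pair, pairing]

theorem le_mul_self (x : M.Num) : x ≤ x * x := by
  rcases eq_zero_or_eq_add_one x with rfl | ⟨y, rfl⟩
  · simp
  · exact ⟨(y + 1) * y, by ring⟩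

theorem left_le_pairing (x y : M.Num) : x ≤ pairing x y := ⟨(x + y) * (x + y), add_comm _ _⟩

theorem right_le_pairing (x y : M.Num) : y ≤ pairing x y :=
  ((le_add_self.trans (le_mul_self (x + y))).trans le_self_add)

theorem sum_le_of_pairing_eq {x y x' y' : M.Num} (h : pairing x y = pairing x' y') :
    x + y ≤ x' + y' := by
  by_contra! hlt
  obtain ⟨z, hz⟩ := add_one_le_iff.2 hlt
  have h' : pairing x' y' < pairing x y := by
    rw [pairing, pairing, ← hz, ← add_one_le_iff]
    -- With `x + y = x' + y' + 1 + z`, this is the difference of the codes minus one.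
    exact ⟨x' + y' + y' + z * (2 * (x' + y' + 1) + z) + x, by ring⟩
  exact h'.ne h.symm

theorem pairing_inj {x y x' y' : M.Num} : pairing x y = pairing x' y' ↔ x = x' ∧ y = y' := by
  refine ⟨fun h => ?_, by rintro ⟨rfl, rfl⟩; rfl⟩
  have hs : x + y = x' + y' := le_antisymm (sum_le_of_pairing_eq h) (sum_le_of_pairing_eq h.symm)
  have hx : x = x' := by
    rw [pairing, pairing, hs] at h
    exact add_left_cancel' h
  exact ⟨hx, add_left_cancel' (x := x) (by rw [hs, hx])⟩

end Coding

end RCAModel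

namespace RCAModel

open Model

variable {M : RCAModel} {V : Ty → Type}

/-! ### Linear orders and the principles, read in a model -/

section Orders

variable (X Y W : M.D Ty.one) (x y : M.Num)

/-- `x ≤_X y`. -/
def LeIn : Prop := X (pairing x y) = 1

/-- `x <_X y`. -/
def LtIn : Prop := LeIn X x y ∧ ¬ LeIn X y x

/-- `x ≤_Y y`, for the suborder `Y` of `X`. -/
def LeOn : Prop := Y x = 1 ∧ Y y = 1 ∧ LeIn X x y

/-- `x <_Y y`, for the suborder `Y` of `X`. -/
def LtOn : Prop := Y x = 1 ∧ Y y = 1 ∧ LtIn X x y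

/-- `X` is an infinite linear order. -/
structure IsLOinf : Prop where
  isSet : ∀ n, X n ≤ 1
  refl : ∀ x y, LeIn X x y → LeIn X x x ∧ LeIn X y y
  trans : ∀ x y z, LeIn X x y → LeIn X y z → LeIn X x z
  antisymm : ∀ x y, LeIn X x y → LeIn X y x → x = y
  total : ∀ x y, LeIn X x x → LeIn X y y → LeIn X x y ∨ LeIn X y x
  infinite : ∀ k, ∃ x, k < x ∧ LeIn X x x

/-- `Y` is a stable suborder of `X`, with witness `W`. -/
structure IsStable : Prop where
  isSet : ∀ n, Y n ≤ 1
  subset : ∀ x, Y x = 1 → LeIn X x x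
  infinite : ∀ k, ∃ y, k < y ∧ Y y = 1
  discrete : ∀ y, Y y = 1 →
    ((∃ x, LtOn X Y x y) → ∃ x, LtOn X Y x y ∧ ∀ z, LtOn X Y z y → LeOn X Y z x) ∧
    ((∃ x, LtOn X Y y x) → ∃ x, LtOn X Y y x ∧ ∀ z, LtOn X Y y z → LeOn X Y x z)
  finite : ∀ y, Y y = 1 →
    (∃ b, ∀ z, LtOn X Y z y → z ≤ b) ∨ ∃ b, ∀ z, LtOn X Y y z → z ≤ b
  witness : ∀ y, Y y = 1 →
    (∀ w, LeOn X Y y w → LeOn X Y w (W y)) ∨ ∀ v, LeOn X Y v y → LeOn X Y (W y) v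

/-- The functionals `Φ₁` and `Φ₂` are as required by `UCADS`. -/
def IsUCADS (Φ₁ Φ₂ : M.D (Ty.one ⇒ Ty.one)) : Prop :=
  ∀ X, IsLOinf X → IsStable X (Φ₁ X) (Φ₂ X)

/-- `f` and `g` agree below `k`. -/
def AgreeBelow (f g : M.D Ty.one) (k : M.Num) : Prop := ∀ i, i < k → f i = g i

/-- `Ξ` is an extensionality functional for `(Φ₁, Φ₂)`. -/
def IsExtensionality (Ξ : M.D (Ty.one ⇒ Ty.one ⇒ Ty.N ⇒ Ty.N))
    (Φ₁ Φ₂ : M.D (Ty.one ⇒ Ty.one)) : Prop :=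
  ∀ f g k, AgreeBelow f g (Ξ f g k) →
    AgreeBelow (Φ₁ f) (Φ₁ g) k ∧ AgreeBelow (Φ₂ f) (Φ₂ g) k

/-- `Z` witnesses that the values of `Φ₁` are infinite. -/
def IsInfinity (Z : M.D (Ty.one ⇒ Ty.N ⇒ Ty.N)) (Φ₁ : M.D (Ty.one ⇒ Ty.one)) : Prop :=
  ∀ X, IsLOinf X → ∀ k, k < Z X k ∧ Φ₁ X (Z X k) = 1

end Orders

section Satisfaction

variable (e : ∀ τ, V τ → M.D τ) (s t k : Term V Ty.N) (X Y W : Term V Ty.one)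

@[simp] theorem sat_le : M.sat e (le s t) ↔ M.eval e s ≤ M.eval e t := by
  simp [le, le_def]

@[simp] theorem sat_lt : M.sat e (lt s t) ↔ M.eval e s < M.eval e t := by
  simp [lt, add_one_le_iff]

@[simp] theorem sat_mem : M.sat e (mem s X) ↔ M.eval e X (M.eval e s) = 1 := by
  simp [mem]

@[simp] theorem sat_leX : M.sat e (leX X s t) ↔ LeIn (M.eval e X) (M.eval e s) (M.eval e t) := by
  simp [leX, LeIn]

@[simp] theorem sat_ltX : M.sat e (ltX X s t) ↔ LtIn (M.eval e X) (M.eval e s) (M.eval e t) := by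
  simp [ltX, LtIn]

@[simp] theorem sat_leY :
    M.sat e (leY X Y s t) ↔ LeOn (M.eval e X) (M.eval e Y) (M.eval e s) (M.eval e t) := by
  simp [leY, LeOn]

@[simp] theorem sat_ltY :
    M.sat e (ltY X Y s t) ↔ LtOn (M.eval e X) (M.eval e Y) (M.eval e s) (M.eval e t) := by
  simp [ltY, LtOn]

@[simp] theorem sat_LOinf : M.sat e (LOinf X) ↔ IsLOinf (M.eval e X) := by
  simp only [LOinf, LO, isSet, sat_and, sat_all, sat_imp, sat_or, sat_ex, sat_le, sat_lt, sat_leX,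
    sat_eq, eval_app, eval_wk, eval_var, consEnv_new, consEnv_old]
  exact ⟨fun ⟨⟨h₁, h₂, h₃, h₄, h₅⟩, h₆⟩ => ⟨h₁, h₂, h₃, h₄, h₅, h₆⟩,
    fun ⟨h₁, h₂, h₃, h₄, h₅, h₆⟩ => ⟨⟨h₁, h₂, h₃, h₄, h₅⟩, h₆⟩⟩

theorem sat_stable : M.sat e (stableSuborder X Y ∧ᶠ stabilityWitness X Y W) ↔
    IsStable (M.eval e X) (M.eval e Y) (M.eval e W) := by
  simp only [stableSuborder, suborder, infinite, discrete, finitelyManyPredOrSucc,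
    stabilityWitness, isSet, sat_and, sat_all, sat_imp, sat_or, sat_ex, sat_le, sat_lt, sat_leX,
    sat_leY, sat_ltY, sat_mem, eval_app, eval_wk, eval_var, consEnv_new, consEnv_old]
  exact ⟨fun ⟨⟨⟨h₁, h₂⟩, h₃, h₄, h₅⟩, h₆⟩ => ⟨h₁, h₂, h₃, h₄, h₅, h₆⟩,
    fun ⟨h₁, h₂, h₃, h₄, h₅, h₆⟩ => ⟨⟨⟨h₁, h₂⟩, h₃, h₄, h₅⟩, h₆⟩⟩

@[simp] theorem sat_isUCADS (Φ₁ Φ₂ : Term V (Ty.one ⇒ Ty.one)) :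
    M.sat e (isUCADS Φ₁ Φ₂) ↔ IsUCADS (M.eval e Φ₁) (M.eval e Φ₂) := by
  simp only [isUCADS, sat_all, sat_imp, sat_stable, sat_LOinf, eval_app, eval_wk, eval_var,
    consEnv_new]
  rfl

@[simp] theorem sat_agreeBelow : M.sat e (agreeBelow X Y k) ↔
    AgreeBelow (M.eval e X) (M.eval e Y) (M.eval e k) := by
  simp [agreeBelow, AgreeBelow]

@[simp] theorem sat_isExtensionalityFunctional (Ξ : Term V (Ty.one ⇒ Ty.one ⇒ Ty.N ⇒ Ty.N))
    (Φ₁ Φ₂ : Term V (Ty.one ⇒ Ty.one)) : M.sat e (isExtensionalityFunctional Ξ Φ₁ Φ₂) ↔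
      IsExtensionality (M.eval e Ξ) (M.eval e Φ₁) (M.eval e Φ₂) := by
  simp [isExtensionalityFunctional, IsExtensionality]

@[simp] theorem sat_isInfinityWitness (Z : Term V (Ty.one ⇒ Ty.N ⇒ Ty.N))
    (Φ₁ : Term V (Ty.one ⇒ Ty.one)) :
    M.sat e (isInfinityWitness Z Φ₁) ↔ IsInfinity (M.eval e Z) (M.eval e Φ₁) := by
  simp [isInfinityWitness, IsInfinity]

end Satisfaction

/-! ### Suborders on which the order is the natural one or its reverse -/

section Increasing

variable {X Y W : M.D Ty.one}

theorem exists_last_lt {y : M.Num} (h : ∃ x, Y x = 1 ∧ x < y) :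
    ∃ x, (Y x = 1 ∧ x < y) ∧ ∀ z, Y z = 1 ∧ z < y → z ≤ x := by
  obtain ⟨x, hx⟩ := h
  exact exists_max (f := M.eval M.self (lam (andT (eqN ((var Y).wk ⬝ v0) one)
    (ltT v0 (var y).wk)))) (fun n => by simp) hx fun k hk => hk.2.le

theorem exists_first_gt {y : M.Num} (h : ∃ x, Y x = 1 ∧ y < x) :
    ∃ x, (Y x = 1 ∧ y < x) ∧ ∀ z, Y z = 1 ∧ y < z → x ≤ z := by
  obtain ⟨x, hx⟩ := h
  exact exists_min (f := M.eval M.self (lam (andT (eqN ((var Y).wk ⬝ v0) one)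
    (ltT (var y).wk v0)))) (fun n => by simp) hx

/-- A set in its natural order or in the reverse of it is a stable suborder. -/
theorem isStable_of_monotone (hset : ∀ n, Y n ≤ 1) (hinf : ∀ k, ∃ y, k < y ∧ Y y = 1)
    (hW : ∀ y, Y y = 1 → Y (W y) = 1 ∧ ∀ z, Y z = 1 → W y ≤ z)
    (h : (∀ x y, Y x = 1 → Y y = 1 → (LeIn X x y ↔ x ≤ y)) ∨
      ∀ x y, Y x = 1 → Y y = 1 → (LeIn X x y ↔ y ≤ x)) : IsStable X Y W := by
  rcases h with h | h
  · have hLe : ∀ x y, LeOn X Y x y ↔ Y x = 1 ∧ Y y = 1 ∧ x ≤ y := fun x y =>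
      and_congr_right fun hx => and_congr_right fun hy => h x y hx hy
    have hLt : ∀ x y, LtOn X Y x y ↔ Y x = 1 ∧ Y y = 1 ∧ x < y := fun x y =>
      and_congr_right fun hx => and_congr_right fun hy => by
        rw [LtIn, h x y hx hy, h y x hy hx, lt_iff_le_not_ge]
    refine ⟨hset, fun x hx => (h x x hx hx).2 le_rfl, hinf, fun y hy => ⟨?_, ?_⟩, ?_, ?_⟩
    · simp only [hLe, hLt, hy, true_and]
      intro hex
      obtain ⟨x, hx, hmax⟩ := exists_last_lt hex
      exact ⟨x, hx, fun z hz => ⟨hz.1, hx.1, hmax z hz⟩⟩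
    · simp only [hLe, hLt, hy, true_and]
      intro hex
      obtain ⟨x, hx, hmin⟩ := exists_first_gt hex
      exact ⟨x, hx, fun z hz => ⟨hx.1, hz.1, hmin z hz⟩⟩
    -- All predecessors of `y` are numerically below `y`.
    · exact fun y hy => Or.inl ⟨y, fun z hz => ((hLt _ _).1 hz).2.2.le⟩
    · exact fun y hy => Or.inr fun v hv =>
        (hLe _ _).2 ⟨(hW y hy).1, hv.1, (hW y hy).2 v hv.1⟩
  · have hLe : ∀ x y, LeOn X Y x y ↔ Y x = 1 ∧ Y y = 1 ∧ y ≤ x := fun x y =>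
      and_congr_right fun hx => and_congr_right fun hy => h x y hx hy
    have hLt : ∀ x y, LtOn X Y x y ↔ Y x = 1 ∧ Y y = 1 ∧ y < x := fun x y =>
      and_congr_right fun hx => and_congr_right fun hy => by
        rw [LtIn, h x y hx hy, h y x hy hx, lt_iff_le_not_ge]
    refine ⟨hset, fun x hx => (h x x hx hx).2 le_rfl, hinf, fun y hy => ⟨?_, ?_⟩, ?_, ?_⟩
    · simp only [hLe, hLt, hy, true_and]
      intro hex
      obtain ⟨x, hx, hmin⟩ := exists_first_gt hex
      exact ⟨x, hx, fun z hz => ⟨hz.1, hx.1, hmin z hz⟩⟩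
    · simp only [hLe, hLt, hy, true_and]
      intro hex
      obtain ⟨x, hx, hmax⟩ := exists_last_lt hex
      exact ⟨x, hx, fun z hz => ⟨hx.1, hz.1, hmax z hz⟩⟩
    · exact fun y hy => Or.inr ⟨y, fun z hz => ((hLt _ _).1 hz).2.2.le⟩
    -- In the reversed order, the least number of `Y` is the last element.
    · exact fun y hy => Or.inl fun w hw =>
        (hLe _ _).2 ⟨hw.2.1, (hW y hy).1, (hW y hy).2 w hw.2.1⟩

/-- The records of `G`, i.e. the elements that come after all smaller numbers in `G`. -/
theorem records {G : M.Num → Prop} {r : M.Num → M.Num → Prop} {g : M.D Ty.one}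
    {q : M.D (Ty.N ⇒ Ty.one)} (hg : ∀ n, g n ≠ 0 ↔ G n) (hq : ∀ x y, q x y ≠ 0 ↔ r x y)
    (hY : ∀ y, Y y = 1 ↔ G y ∧ ∀ z, z < y → G z → r z y) (hne : ∃ x, G x)
    (hnext : ∀ x, G x → ∃ y, G y ∧ r x y)
    (htrans : ∀ x y z, r x y → r y z → r x z) (hirr : ∀ x, ¬ r x x)
    (htotal : ∀ x y, G x → G y → x ≠ y → r x y ∨ r y x) :
    (∀ k, ∃ y, k < y ∧ Y y = 1) ∧ ∀ x y, Y x = 1 → Y y = 1 → (r x y ↔ x < y) := by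
  have hmono : ∀ x y, Y x = 1 → Y y = 1 → x < y → r x y := fun x y hx hy hxy =>
    ((hY y).1 hy).2 x hxy ((hY x).1 hx).1
  refine ⟨fun k => ?_, fun x y hx hy => ⟨fun hr => ?_, hmono x y hx hy⟩⟩
  -- The next record after `x` is the numerically least member of `G` that comes after `x`.
  · have hstep : ∀ x, Y x = 1 → ∃ y, x < y ∧ Y y = 1 := by
      intro x hx
      obtain ⟨y, hy⟩ := hnext x ((hY x).1 hx).1
      obtain ⟨m, ⟨hmG, hmr⟩, hmin⟩ := exists_min (P := fun y => G y ∧ r x y)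
        (f := M.eval M.self (lam (andT ((var g).wk ⬝ v0) ((var q).wk ⬝ (var x).wk ⬝ v0))))
        (fun n => by simp [hg, hq]) hy
      have hcmp : ∀ z, G z → ¬ r x z → r z m := by
        intro z hz hxz
        by_cases h : z = x
        · exact h ▸ hmr
        · exact htrans _ _ _ ((htotal z x hz ((hY x).1 hx).1 h).resolve_right hxz) hmr
      refine ⟨m, ?_, (hY m).2 ⟨hmG, fun z hz hzG => hcmp z hzG fun hr => ?_⟩⟩
      · by_contra! hle
        rcases hle.lt_or_eq with hlt | rfl
        · exact hirr _ (htrans _ _ _ hmr (((hY x).1 hx).2 m hlt hmG))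
        · exact hirr _ hmr
      · exact absurd (hmin z ⟨hzG, hr⟩) (not_le.2 hz)
    obtain ⟨a, ha⟩ := hne
    obtain ⟨m, hm, hmin⟩ := exists_min hg ha
    have hmY : Y m = 1 := (hY m).2 ⟨hm, fun z hz hzG => absurd (hmin z hzG) (not_le.2 hz)⟩
    rcases lt_or_ge k m with hkm | hkm
    · exact ⟨m, hkm, hmY⟩
    -- Unboundedness is not a quantifier-free induction statement; instead, the step is applied to
    -- the largest record up to `k`.
    · obtain ⟨x, hx, hmax⟩ := exists_last_lt (Y := Y) ⟨m, hmY, lt_add_one_iff.2 hkm⟩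
      obtain ⟨y, hxy, hy⟩ := hstep x hx.1
      refine ⟨y, ?_, hy⟩
      by_contra! hle
      exact absurd (hmax y ⟨hy, lt_add_one_iff.2 hle⟩) (not_le.2 hxy)
  · by_contra! hle
    rcases hle.lt_or_eq with hlt | rfl
    · exact hirr _ (htrans _ _ _ hr (hmono y x hy hx hlt))
    · exact hirr _ hr

end Increasing

end RCAModel

/-! ### The realizing terms -/

namespace Term

variable {V : Ty → Type}

/-- The truth value of `s ≤_X t`. -/
def leInT (X : Term V Ty.one) (s t : Term V Ty.N) : Term V Ty.N := eqN (X ⬝ pair s t) one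

/-- The truth value of `s <_X t`. -/
def ltInT (X : Term V Ty.one) (s t : Term V Ty.N) : Term V Ty.N :=
  andT (leInT X s t) (notT (leInT X t s))

/-- From `μ` and `X`, the set of all elements of `X` with finitely many successors. -/
def finSuccC : ClosedTerm (Ty.two ⇒ Ty.one ⇒ Ty.one) :=
  lam (lam (lam (andT (leInT v1 v0 v0)
    (exT v2 (allT v3 (impT (ltInT v3 v2 v0) (leT v0 v1)))))))

/-- From `μ` and `X`, whether there are infinitely many elements with finitely many successors. -/
def caseC : ClosedTerm (Ty.two ⇒ Ty.one ⇒ Ty.N) :=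
  lam (lam (allT v1 (exT v2 (andT (ltT v1 v0) (ofClosed finSuccC ⬝ v3 ⬝ v2 ⬝ v0)))))

/-- From `μ` and `X`, the set of elements with finitely many successors if it is infinite, and
its complement otherwise. -/
def goodC : ClosedTerm (Ty.two ⇒ Ty.one ⇒ Ty.one) :=
  lam (lam (lam (iteT (ofClosed caseC ⬝ v2 ⬝ v1) (ofClosed finSuccC ⬝ v2 ⬝ v1 ⬝ v0)
    (andT (leInT v1 v0 v0) (notT (ofClosed finSuccC ⬝ v2 ⬝ v1 ⬝ v0))))))

/-- From `μ` and `X`, the order of `X` or its reverse. -/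
def beforeC : ClosedTerm (Ty.two ⇒ Ty.one ⇒ Ty.N ⇒ Ty.one) :=
  lam (lam (lam (lam (iteT (ofClosed caseC ⬝ v3 ⬝ v2) (ltInT v2 v0 v1) (ltInT v2 v1 v0)))))

/-- From `μ` and `X`, a stable suborder of `X`. -/
def suborderC : ClosedTerm (Ty.two ⇒ Ty.one ⇒ Ty.one) :=
  lam (lam (lam (andT (ofClosed goodC ⬝ v2 ⬝ v1 ⬝ v0) (ballT v0
    (impT (ofClosed goodC ⬝ v3 ⬝ v2 ⬝ v0) (ofClosed beforeC ⬝ v3 ⬝ v2 ⬝ v0 ⬝ v1))))))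

/-- From `μ` and `X`, a witness to the stability of the suborder. -/
def witnessC : ClosedTerm (Ty.two ⇒ Ty.one ⇒ Ty.one) :=
  lam (lam (lam (least (succ v0) (ofClosed suborderC ⬝ v3 ⬝ v2 ⬝ v0))))

/-- From `f`, whether some number up to `x` is a zero of `f`. -/
def pastC : ClosedTerm (Ty.one ⇒ Ty.one) := lam (lam (bexT (succ v0) (notT (v2 ⬝ v0))))

/-- From `f`, the order on the numbers in which those from the first zero of `f` on come first. -/
def orderC : ClosedTerm (Ty.one ⇒ Ty.one) :=
  lam (lam (bexT (succ v0) (bexT (succ v1) (andT (eqN v2 (pair v1 v0)) (orT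
    (andT (ofClosed pastC ⬝ v3 ⬝ v1) (impT (ofClosed pastC ⬝ v3 ⬝ v0) (leT v1 v0)))
    (andT (notT (ofClosed pastC ⬝ v3 ⬝ v1))
      (andT (notT (ofClosed pastC ⬝ v3 ⬝ v0)) (leT v1 v0))))))))

/-- The natural order on the numbers. -/
def naturalC : ClosedTerm Ty.one := ofClosed orderC ⬝ lam one

/-- From an extensionality functional and a second element of the suborder of the natural order,
a search operator. -/
def muC : ClosedTerm ((Ty.one ⇒ Ty.one ⇒ Ty.N ⇒ Ty.N) ⇒ Ty.N ⇒ Ty.two) :=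
  lam (lam (lam (least (succ (add (v2 ⬝ ofClosed naturalC ⬝ (ofClosed orderC ⬝ v0) ⬝ succ v1) v1))
    (notT (v1 ⬝ v0)))))

end Term


namespace RCAModel

open Model

variable {M : RCAModel} {V : Ty → Type}

@[simp] theorem eval_leInT (e : ∀ τ, V τ → M.D τ) (X : Term V Ty.one) (s t : Term V Ty.N) :
    M.eval e (leInT X s t) = chi (LeIn (M.eval e X) (M.eval e s) (M.eval e t)) := by
  simp [leInT, LeIn]

@[simp] theorem eval_ltInT (e : ∀ τ, V τ → M.D τ) (X : Term V Ty.one) (s t : Term V Ty.N) :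
    M.eval e (ltInT X s t) = chi (LtIn (M.eval e X) (M.eval e s) (M.eval e t)) := by
  simp [ltInT, LtIn]

/-! ### From the search operator to stable suborders -/

section MuToUCADS

variable {m : M.D Ty.two} (hm : IsMu m) (X : M.D Ty.one)

/-- `x` is an element of `X` with finitely many successors. -/
def FinSucc (X : M.D Ty.one) (x : M.Num) : Prop :=
  LeIn X x x ∧ ∃ b, ∀ z, LtIn X x z → z ≤ b

include hm

theorem val_finSuccC (x : M.Num) : M.val finSuccC m X x = chi (FinSucc X x) := by
  simp [finSuccC, muEx_iff hm, FinSucc]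

theorem val_caseC : M.val caseC m X = chi (∀ b, ∃ x, b < x ∧ FinSucc X x) := by
  simp [caseC, muEx_iff hm, val_finSuccC hm]

theorem isUCADS_of_isMu : IsUCADS (M.val suborderC m) (M.val witnessC m) := by
  intro X hX
  set g := M.val goodC m X with hg
  set q := M.val beforeC m X with hq
  have hYeq : ∀ y, M.val suborderC m X y = chi (g y ≠ 0 ∧ ∀ z, z < y → g z ≠ 0 → q z y ≠ 0) := by
    intro y
    simp [suborderC, hg, hq]
  have hY : ∀ y, M.val suborderC m X y = 1 ↔ g y ≠ 0 ∧ ∀ z, z < y → g z ≠ 0 → q z y ≠ 0 := by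
    intro y
    rw [hYeq, chi_eq_one]
  have hirr : ∀ x, ¬ LtIn X x x := fun x h => h.2 h.1
  have htrans : ∀ x y z, LtIn X x y → LtIn X y z → LtIn X x z := fun x y z hxy hyz =>
    ⟨hX.trans _ _ _ hxy.1 hyz.1, fun h => hxy.2 (hX.trans _ _ _ hyz.1 h)⟩
  have htotal : ∀ x y, LeIn X x x → LeIn X y y → x ≠ y → LtIn X x y ∨ LtIn X y x := by
    intro x y hx hy hne
    rcases hX.total x y hx hy with h | h
    · exact Or.inl ⟨h, fun h' => hne (hX.antisymm _ _ h h')⟩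
    · exact Or.inr ⟨h, fun h' => hne (hX.antisymm _ _ h' h)⟩
  have hW : ∀ y, M.val suborderC m X y = 1 →
      M.val suborderC m X (M.val witnessC m X y) = 1 ∧
        ∀ z, M.val suborderC m X z = 1 → M.val witnessC m X y ≤ z := by
    intro y hy
    -- The search up to `y` succeeds because `y` is itself in the suborder, and it always returns
    -- the least element.
    have hWy : M.val witnessC m X y = search (M.val suborderC m X) (y + 1) := by
      simp only [witnessC, val_lam, eval_lam, eval_least]
      congr 1
      · exact ext fun z => by simp
      · simp
    have hne : ∀ z, M.val suborderC m X z ≠ 0 ↔ M.val suborderC m X z = 1 := by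
      intro z
      rw [hYeq, chi_eq_one, Ne, chi_eq_zero, Classical.not_not]
    have h := fun z hz => search_of_lt (M.val suborderC m X) (y + 1) z ((hne z).2 hz)
    rw [hWy]
    have hself := h y hy (lt_add_one_iff.2 le_rfl)
    refine ⟨(hne _).1 hself.2, fun z hz => ?_⟩
    rcases le_total z y with hzy | hzy
    · exact (h z hz (lt_add_one_iff.2 hzy)).1
    · exact hself.1.trans hzy
  have hset : ∀ n, M.val suborderC m X n ≤ 1 := fun n => by rw [hYeq]; exact chi_le_one _
  have hgY : ∀ y, M.val suborderC m X y = 1 → g y ≠ 0 := fun y hy => ((hY y).1 hy).1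
  by_cases hc : ∀ b, ∃ x, b < x ∧ FinSucc X x
  · have hg' : ∀ x, g x ≠ 0 ↔ FinSucc X x := by
      intro x
      simp [hg, goodC, val_caseC hm, val_finSuccC hm, hc]
    have hq' : ∀ x y, q x y ≠ 0 ↔ LtIn X y x := by
      intro x y
      simp [hq, beforeC, val_caseC hm, hc]
    simp only [hg', hq'] at hY hgY
    obtain ⟨hinf, hmono⟩ := records hg' hq' hY ((hc 0).imp fun x hx => hx.2)
      (fun x hx => by
        obtain ⟨b, hb⟩ := hx.2
        -- Being beyond `b` excludes that `y` is a successor of `x`, being beyond `x` excludes `y =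
        -- x`; so `y` lies below `x` in `X`.
        obtain ⟨y, hby, hy⟩ := hc (b + x)
        refine ⟨y, hy, (htotal x y hx.1 hy.1 ?_).resolve_left fun h => ?_⟩
        · rintro rfl
          exact absurd hby (not_lt.2 le_add_self)
        · exact absurd ((hb y h).trans le_self_add) (not_le.2 hby))
      (fun x y z hxy hyz => htrans _ _ _ hyz hxy) hirr
      fun x y hx hy hne => (htotal x y hx.1 hy.1 hne).symm
    refine isStable_of_monotone hset hinf hW (Or.inr fun x y hx hy => ?_)
    rw [← not_lt, ← hmono x y hx hy, LtIn, not_and_not_right]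
    refine ⟨fun h _ => h, fun h => ?_⟩
    rcases hX.total x y (hgY x hx).1 (hgY y hy).1 with h' | h'
    · exact h'
    · exact h h'
  · have hg' : ∀ x, g x ≠ 0 ↔ LeIn X x x ∧ ¬ FinSucc X x := by
      intro x
      simp [hg, goodC, val_caseC hm, val_finSuccC hm, hc]
    have hq' : ∀ x y, q x y ≠ 0 ↔ LtIn X x y := by
      intro x y
      simp [hq, beforeC, val_caseC hm, hc]
    simp only [hg', hq'] at hY hgY
    push Not at hc
    obtain ⟨b, hb⟩ := hc
    obtain ⟨hinf, hmono⟩ := records hg' hq' hY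
      ((hX.infinite b).imp fun x hx => ⟨hx.2, hb x hx.1⟩)
      (fun x hx => by
        have := hx.2
        simp only [FinSucc, not_and, not_exists, not_forall] at this
        -- A successor of `x` beyond `b`: by the choice of `b`, it again has infinitely many
        -- successors.
        obtain ⟨z, hz, hbz⟩ := this hx.1 b
        exact ⟨z, ⟨(hX.refl _ _ hz.1).2, hb z (not_le.1 hbz)⟩, hz⟩)
      htrans hirr fun x y hx hy hne => htotal x y hx.1 hy.1 hne
    refine isStable_of_monotone hset hinf hW (Or.inl fun x y hx hy => ?_)
    rw [← not_lt, ← hmono y x hy hx, LtIn, not_and_not_right]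
    refine ⟨fun h _ => h, fun h => ?_⟩
    rcases hX.total x y (hgY x hx).1 (hgY y hy).1 with h' | h'
    · exact h'
    · exact h h'

end MuToUCADS

/-! ### From stable suborders to the search operator -/

section UCADSToMu

/-- Some number up to `x` is a zero of `f`. -/
def Past (f : M.D Ty.one) (x : M.Num) : Prop := ∃ i, i ≤ x ∧ f i = 0

theorem val_pastC (f : M.D Ty.one) (x : M.Num) : M.val pastC f x = chi (Past f x) := by
  simp [pastC, lt_add_one_iff, Past]

/-- The order in which the numbers past a zero of `f` come first. -/
def Before (f : M.D Ty.one) (a b : M.Num) : Prop :=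
  (Past f a ∧ (Past f b → a ≤ b)) ∨ (¬ Past f a ∧ ¬ Past f b ∧ a ≤ b)

/-- Both components of a pair are bounded by its code, so decoding takes only bounded search. -/
theorem val_orderC (f : M.D Ty.one) (c : M.Num) : M.val orderC f c =
    chi (∃ a, a ≤ c ∧ ∃ b, b ≤ c ∧ c = pairing a b ∧ Before f a b) := by
  simp only [orderC, val_lam, eval_lam, eval_bexT, eval_andT, eval_orT, eval_notT, eval_impT,
    eval_eqN, eval_leT, eval_pair, eval_app, eval_ofClosed, eval_var, eval_const, con_succ,
    consEnv_new, consEnv_old, val_pastC, lt_add_one_iff, Ne, chi_eq_zero, Classical.not_not, Before]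

theorem leIn_orderC (f : M.D Ty.one) (a b : M.Num) :
    LeIn (M.val orderC f) a b ↔ Before f a b := by
  rw [LeIn, val_orderC, chi_eq_one]
  constructor
  · rintro ⟨a', -, b', -, h, hB⟩
    obtain ⟨rfl, rfl⟩ := pairing_inj.1 h
    exact hB
  · exact fun h => ⟨a, left_le_pairing a b, b, right_le_pairing a b, rfl, h⟩

/-- `Past f` is an upward closed set of numbers; the order puts it in front of its complement, each
part in natural order. -/
theorem isLOinf_orderC (f : M.D Ty.one) : IsLOinf (M.val orderC f) := by
  have hrefl : ∀ x, Before f x x := fun x => by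
    unfold Before
    have := le_refl x
    tauto
  have hpast : ∀ x y, x ≤ y → Past f x → Past f y := by
    rintro x y hxy ⟨i, hi, hf⟩
    exact ⟨i, hi.trans hxy, hf⟩
  refine ⟨fun n => ?_, fun x y _ => ?_, fun x y z hxy hyz => ?_, fun x y hxy hyx => ?_,
    fun x y _ _ => ?_, fun k => ?_⟩
  · rw [val_orderC]
    exact chi_le_one _
  · simp only [leIn_orderC]
    exact ⟨hrefl _, hrefl _⟩
  · rw [leIn_orderC] at *
    have := le_trans (a := x) (b := y) (c := z)
    unfold Before at *
    tauto
  · rw [leIn_orderC] at *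
    have := le_antisymm (a := x) (b := y)
    unfold Before at *
    tauto
  · rw [leIn_orderC, leIn_orderC]
    have := le_total x y
    unfold Before
    tauto
  · exact ⟨k + 1, lt_add_one_iff.2 le_rfl, (leIn_orderC _ _ _).2 (hrefl _)⟩

theorem leIn_naturalC (a b : M.Num) : LeIn (M.val naturalC) a b ↔ a ≤ b := by
  have : M.val naturalC = M.val orderC (M.eval M.noEnv (lam one)) := by
    simp [naturalC, val]
  rw [this, leIn_orderC]
  simp [Before, Past]

theorem isLOinf_naturalC : IsLOinf (M.val naturalC) := by
  have : M.val naturalC = M.val orderC (M.eval M.noEnv (lam one)) := by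
    simp [naturalC, val]
  rw [this]
  exact isLOinf_orderC _

/-- Below the first zero of `f`, the order given by `f` is the natural order. -/
theorem agreeBelow_orderC {f : M.D Ty.one} {k : M.Num} (hf : ∀ i, i < k → f i ≠ 0) :
    AgreeBelow (M.val naturalC) (M.val orderC f) k := by
  have hnat : M.val naturalC = M.val orderC (M.eval M.noEnv (lam one)) := by
    simp [naturalC, val]
  intro c hc
  rw [hnat, val_orderC, val_orderC]
  -- The value at a code `c < k` only involves components up to `c`, all of them before any zero of
  -- `f`.
  have hpast : ∀ a, a ≤ c → (Past f a ↔ False) := fun a ha =>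
    iff_of_false (fun ⟨i, hi, hfi⟩ => hf i ((hi.trans ha).trans_lt hc) hfi) id
  refine chi_congr (exists_congr fun a => and_congr_right fun ha => exists_congr fun b =>
    and_congr_right fun hb => and_congr_right fun _ => ?_)
  unfold Before
  rw [hpast a ha, hpast b hb]
  simp [Past]

variable {Φ₁ Φ₂ : M.D (Ty.one ⇒ Ty.one)} (hΦ : IsUCADS Φ₁ Φ₂)
include hΦ

/-- If `f` had a zero but none up to the search bound, then `Φ` would take the same values at `y₀`
and `y₁` on the natural order and on the order given by `f`. A single stability witness at `y₀`
cannot serve both. -/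
theorem isMu_of_isUCADS {Ξ : M.D (Ty.one ⇒ Ty.one ⇒ Ty.N ⇒ Ty.N)}
    (hΞ : IsExtensionality Ξ Φ₁ Φ₂) {y₀ y₁ : M.Num} (hlt : y₀ < y₁)
    (h₀ : Φ₁ (M.val naturalC) y₀ = 1) (h₁ : Φ₁ (M.val naturalC) y₁ = 1) :
    IsMu (M.val muC Ξ y₁) := by
  rintro f ⟨n, hn⟩
  -- Agreement of the values below `y₁ + 1` covers both `y₀` and `y₁`. Adding `y₁` to the bound
  -- ensures that these two are not past a zero either.
  set N := Ξ (M.val naturalC) (M.val orderC f) (y₁ + 1) + y₁ with hN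
  obtain ⟨g, hg⟩ : ∃ g : M.D Ty.one, g = M.eval M.self (lam (notT ((var f).wk ⬝ v0))) := ⟨_, rfl⟩
  have hgf : ∀ i, g i ≠ 0 ↔ f i = 0 := by
    intro i
    simp [hg]
  have hval : M.val muC Ξ y₁ f = search g (N + 1) := by
    simp only [muC, val_lam, eval_lam, eval_least]
    congr 1
    · rw [hg]
      exact ext fun z => by simp
    · simp [hN]
  rw [hval]
  by_cases hex : ∃ i, i < N + 1 ∧ f i = 0
  · obtain ⟨i, hi, hfi⟩ := hex
    exact (hgf _).1 (search_of_lt g (N + 1) i ((hgf i).2 hfi) hi).2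
  exfalso
  push Not at hex
  have hX₀ := hΦ _ isLOinf_naturalC
  have hX := hΦ _ (isLOinf_orderC f)
  set X₀ := M.val naturalC
  set X := M.val orderC f
  have hnp : ∀ x, x ≤ N → ¬ Past f x := fun x hx ⟨i, hi, hfi⟩ =>
    hex i (lt_add_one_iff.2 (hi.trans hx)) hfi
  have hy₁N : y₁ ≤ N := le_add_self
  obtain ⟨hag₁, hag₂⟩ := hΞ X₀ X (y₁ + 1) (agreeBelow_orderC fun i hi =>
    hex i (hi.trans_le (le_self_add.trans le_self_add)))
  have hlt₀ : y₀ < y₁ + 1 := lt_add_one_iff.2 hlt.le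
  have hlt₁ : y₁ < y₁ + 1 := lt_add_one_iff.2 le_rfl
  have h₀' : Φ₁ X y₀ = 1 := hag₁ y₀ hlt₀ ▸ h₀
  have h₁' : Φ₁ X y₁ = 1 := hag₁ y₁ hlt₁ ▸ h₁
  set a := Φ₂ X₀ y₀ with ha
  have ha' : Φ₂ X y₀ = a := (hag₂ y₀ hlt₀).symm
  have hay : a ≤ y₀ := by
    rcases hX₀.witness y₀ h₀ with h | h
    · have haY := (h y₀ ⟨h₀, h₀, (leIn_naturalC _ _).2 le_rfl⟩)
      -- In the natural order, `y₀` has unboundedly many successors in the suborder, so `a` cannot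
      -- be an upper bound.
      obtain ⟨w, hw, hwY⟩ := hX₀.infinite (a + y₀)
      have := h w ⟨h₀, hwY, (leIn_naturalC _ _).2 (le_add_self.trans hw.le)⟩
      have hwa := (leIn_naturalC _ _).1 this.2.2
      exact absurd (le_self_add.trans_lt hw) (not_lt.2 hwa)
    · exact (leIn_naturalC _ _).1 (h y₀ ⟨h₀, h₀, (leIn_naturalC _ _).2 le_rfl⟩).2.2
  have hy₀N : y₀ ≤ N := hlt.le.trans hy₁N
  have hpast : ∀ x, n ≤ x → Past f x := fun x hx => ⟨n, hx, hn⟩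
  have hB : ∀ x y, LeIn X x y ↔ Before f x y := leIn_orderC f
  rcases hX.witness y₀ h₀' with h | h
  · rw [ha'] at h
    -- As an upper bound, `a` would have to be at least `y₁ > y₀ ≥ a`.
    have := (hB _ _).1 (h y₁ ⟨h₀', h₁', (hB _ _).2 (Or.inr
      ⟨hnp _ hy₀N, hnp _ hy₁N, hlt.le⟩)⟩).2.2
    rcases this with h | h
    · exact hnp _ hy₁N h.1
    · exact absurd (h.2.2.trans hay) (not_le.2 hlt)
  · rw [ha'] at h
    -- An element `v > n` of the suborder has been moved in front of `y₀`. As a lower bound, `a`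
    -- would have to come before `v`, though `a` is not past a zero.
    obtain ⟨v, hv, hvY⟩ := hX.infinite n
    have := (hB _ _).1 (h v ⟨hvY, h₀', (hB _ _).2 (Or.inl
      ⟨hpast v hv.le, fun h => absurd h (hnp _ hy₀N)⟩)⟩).2.2
    rcases this with h | h
    · exact hnp _ (hay.trans hy₀N) h.1
    · exact h.2.1 (hpast v hv.le)

end UCADSToMu

end RCAModel

/-! ### Existence of extensionality functionals and infinity witnesses -/

namespace Term

/-- The first component of the pair with code `c`. -/
def fstC : ClosedTerm Ty.one := lam (least (succ v0) (bexT (succ v1) (eqN v2 (pair v1 v0))))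

/-- The second component of the pair with code `c`. -/
def sndC : ClosedTerm Ty.one := lam (least (succ v0) (bexT (succ v1) (eqN v2 (pair v0 v1))))

/-- The code of two functions `f` and `g` and a number `k`. -/
def codeC : ClosedTerm (Ty.one ⇒ Ty.one ⇒ Ty.N ⇒ Ty.one) :=
  lam (lam (lam (lam (pair (pair (v3 ⬝ v0) (v2 ⬝ v0)) v1))))

/-- The function `f` from the code of `f`, `g` and `k`. -/
def decodeLeftC : ClosedTerm (Ty.one ⇒ Ty.one) :=
  lam (lam (ofClosed fstC ⬝ (ofClosed fstC ⬝ (v1 ⬝ v0))))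

/-- The function `g` from the code of `f`, `g` and `k`. -/
def decodeRightC : ClosedTerm (Ty.one ⇒ Ty.one) :=
  lam (lam (ofClosed sndC ⬝ (ofClosed fstC ⬝ (v1 ⬝ v0))))

/-- Whether `f` and `g` agree below `k`. -/
def agreeC : ClosedTerm (Ty.one ⇒ Ty.one ⇒ Ty.N ⇒ Ty.N) :=
  lam (lam (lam (ballT v0 (eqN (v3 ⬝ v0) (v2 ⬝ v0)))))

/-- From `Φ₁`, `Φ₂`, `f`, `g` and `k`, whether agreement of `f` and `g` below `n` ensures that
their images agree below `k`. -/
def modulusC : ClosedTerm ((Ty.one ⇒ Ty.one) ⇒ (Ty.one ⇒ Ty.one) ⇒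
    Ty.one ⇒ Ty.one ⇒ Ty.N ⇒ Ty.N ⇒ Ty.N) :=
  lam (lam (lam (lam (lam (lam (impT (ofClosed agreeC ⬝ v3 ⬝ v2 ⬝ v0)
    (andT
      (ofClosed agreeC ⬝ (var (.old (.old (.old (.old (.old .new))))) ⬝ v3) ⬝
        (var (.old (.old (.old (.old (.old .new))))) ⬝ v2) ⬝ v1)
      (ofClosed agreeC ⬝ (var (.old (.old (.old (.old .new)))) ⬝ v3) ⬝
        (var (.old (.old (.old (.old .new)))) ⬝ v2) ⬝ v1))))))))

end Term

namespace RCAModel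

open Model

variable {M : RCAModel} {V : Ty → Type}

theorem choice (q : M.D (Ty.one ⇒ Ty.one)) (h : ∀ f, ∃ n, q f n ≠ 0) :
    ∃ F : M.D Ty.two, ∀ f, q f (F f) ≠ 0 := by
  have hc := M.isRCA.valid (Axiom.choice
    (Formula.not (var (.old (.old q)) ⬝ v1 ⬝ v0 ≐ zero)) ((QF.eq _ _).imp QF.bot)) M.self
  simpa [sat_subst, choiceSubst] using hc (by simpa using h)

theorem val_fstC (x y : M.Num) : M.val fstC (pairing x y) = x := by
  simp only [fstC, val_lam, eval_least]
  set f := M.eval (consEnv M.noEnv (pairing x y)) (lam (bexT (Term.succ v1) (eqN v2 (pair v1 v0))))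
    with hf
  have hfi : ∀ i, f i ≠ 0 ↔ i = x := by
    intro i
    simp only [hf, eval_lam, eval_bexT, eval_eqN, eval_pair, eval_var, consEnv_new, consEnv_old,
      eval_app, eval_const, con_succ, lt_add_one_iff, Ne, chi_eq_zero, Classical.not_not]
    refine ⟨fun ⟨j, _, h⟩ => (pairing_inj.1 h).1.symm, ?_⟩
    rintro rfl
    exact ⟨y, right_le_pairing _ _, rfl⟩
  exact (hfi _).1 (search_of_lt f _ x ((hfi x).2 rfl)
    (by simpa [lt_add_one_iff] using left_le_pairing x y)).2

theorem val_sndC (x y : M.Num) : M.val sndC (pairing x y) = y := by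
  simp only [sndC, val_lam, eval_least]
  set f := M.eval (consEnv M.noEnv (pairing x y)) (lam (bexT (Term.succ v1) (eqN v2 (pair v0 v1))))
    with hf
  have hfi : ∀ i, f i ≠ 0 ↔ i = y := by
    intro i
    simp only [hf, eval_lam, eval_bexT, eval_eqN, eval_pair, eval_var, consEnv_new, consEnv_old,
      eval_app, eval_const, con_succ, lt_add_one_iff, Ne, chi_eq_zero, Classical.not_not]
    refine ⟨fun ⟨j, _, h⟩ => (pairing_inj.1 h).2.symm, ?_⟩
    rintro rfl
    exact ⟨x, left_le_pairing _ _, rfl⟩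
  exact (hfi _).1 (search_of_lt f _ y ((hfi y).2 rfl)
    (by simpa [lt_add_one_iff] using right_le_pairing x y)).2

theorem val_agreeC (f g : M.D Ty.one) (k : M.Num) :
    M.val agreeC f g k = chi (AgreeBelow f g k) := by
  simp [agreeC, AgreeBelow]

theorem val_modulusC (Φ₁ Φ₂ : M.D (Ty.one ⇒ Ty.one)) (f g : M.D Ty.one) (k n : M.Num) :
    M.val modulusC Φ₁ Φ₂ f g k n = chi (AgreeBelow f g n →
      AgreeBelow (Φ₁ f) (Φ₁ g) k ∧ AgreeBelow (Φ₂ f) (Φ₂ g) k) := by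
  simp [modulusC, val_agreeC]

/-- The choice axiom takes a single argument of type `1`, so `f`, `g` and `k` are coded into one
function. The matrix is an equation between terms because agreement below a number is a bounded
statement. Nothing about `Φ` is needed beyond extensionality of the model. -/
theorem exists_isExtensionality (Φ₁ Φ₂ : M.D (Ty.one ⇒ Ty.one)) :
    ∃ Ξ, IsExtensionality Ξ Φ₁ Φ₂ := by
  obtain ⟨F, hF⟩ := choice (M.eval M.self (lam ((var (M.val modulusC Φ₁ Φ₂)).wk ⬝
    (ofClosed decodeLeftC ⬝ v0) ⬝ (ofClosed decodeRightC ⬝ v0) ⬝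
    (ofClosed sndC ⬝ (v0 ⬝ zero))))) (fun h => by
      simp only [eval_lam, eval_app, eval_wk, eval_var, eval_ofClosed, consEnv_new, val_modulusC,
        Ne, chi_eq_zero, Classical.not_not]
      set f := M.val decodeLeftC h
      set g := M.val decodeRightC h
      -- If `f` and `g` differ at `i`, the bound `i + 1` makes the premise false; if not, they are
      -- equal and any bound works.
      by_cases hfg : ∃ i, f i ≠ g i
      · obtain ⟨i, hi⟩ := hfg
        exact ⟨i + 1, fun ha => absurd (ha i (lt_add_one_iff.2 le_rfl)) hi⟩
      · push Not at hfg
        rw [ext hfg]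
        exact ⟨0, fun _ => ⟨fun _ _ => rfl, fun _ _ => rfl⟩⟩)
  refine ⟨M.eval M.self (lam (lam (lam ((var F).wk.wk.wk ⬝ (ofClosed codeC ⬝ v2 ⬝ v1 ⬝ v0))))),
    fun f g k => ?_⟩
  have h := hF (M.val codeC f g k)
  have hl : M.val decodeLeftC (M.val codeC f g k) = f :=
    ext fun x => by simp [decodeLeftC, codeC, val_fstC]
  have hr : M.val decodeRightC (M.val codeC f g k) = g :=
    ext fun x => by simp [decodeRightC, codeC, val_fstC, val_sndC]
  have hk : M.val sndC (M.val codeC f g k 0) = k := by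
    simp [codeC, val_sndC]
  simp only [eval_lam, eval_app, eval_wk, eval_var, eval_ofClosed, consEnv_new, val_modulusC,
    eval_zero, hl, hr, hk, Ne, chi_eq_zero, Classical.not_not] at h
  simpa using h

theorem exists_isInfinity {m : M.D Ty.two} (hm : IsMu m) {Φ₁ Φ₂ : M.D (Ty.one ⇒ Ty.one)}
    (hΦ : IsUCADS Φ₁ Φ₂) : ∃ Z, IsInfinity Z Φ₁ := by
  refine ⟨M.eval M.self (lam (lam ((var m).wk.wk ⬝ lam (notT (andT (ltT v1 v0)
    (eqN ((var Φ₁).wk.wk.wk ⬝ v2 ⬝ v0) one)))))), fun X hX k => ?_⟩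
  obtain ⟨y, hy⟩ := (hΦ X hX).infinite k
  obtain ⟨q, hq⟩ : ∃ q : M.D Ty.one, q = M.eval (consEnv (consEnv M.self X) k)
    (lam (notT (andT (ltT v1 v0) (eqN ((var Φ₁).wk.wk.wk ⬝ v2 ⬝ v0) one)))) := ⟨_, rfl⟩
  have hqi : ∀ i, q i = 0 ↔ k < i ∧ Φ₁ X i = 1 := by
    intro i
    simp [hq]
  have := (hqi _).1 (hm q ⟨y, (hqi y).2 hy⟩)
  simpa [hq] using this

/-- Only two elements of one suborder are needed here, so no functional witnessing infinity is
involved. -/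
theorem exists_isMu {Φ₁ Φ₂ : M.D (Ty.one ⇒ Ty.one)} (hΦ : IsUCADS Φ₁ Φ₂) :
    ∃ m : M.D Ty.two, IsMu m := by
  obtain ⟨Ξ, hΞ⟩ := exists_isExtensionality Φ₁ Φ₂
  have h := (hΦ _ isLOinf_naturalC).infinite
  obtain ⟨y₀, -, h₀⟩ := h 0
  obtain ⟨y₁, hlt, h₁⟩ := h y₀
  exact ⟨_, isMu_of_isUCADS hΦ hΞ hlt h₀ h₁⟩

end RCAModel

namespace Term

/-- From `Φ₁`, `Φ₂`, an extensionality functional for them and a witness to the infinity of the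
suborders, a search operator. -/
def searchOperatorC : ClosedTerm ((Ty.one ⇒ Ty.one) ⇒ (Ty.one ⇒ Ty.one) ⇒
    (Ty.one ⇒ Ty.one ⇒ Ty.N ⇒ Ty.N) ⇒ (Ty.one ⇒ Ty.N ⇒ Ty.N) ⇒ Ty.two) :=
  lam (lam (lam (lam (ofClosed muC ⬝ v1 ⬝
    (v0 ⬝ ofClosed naturalC ⬝ (v0 ⬝ ofClosed naturalC ⬝ zero))))))

end Term

open RCAModel in
/-- Completeness, for the sentences that hold in all bundled models. -/
theorem provableInRCA {φ : Sentence} (h : ∀ M : RCAModel, M.sat M.noEnv φ) : ProvableInRCA φ :=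
  provableInRCA_of_sat fun M hM e => by
    have he : e = M.noEnv := by
      funext τ x
      exact nomatch x
    exact he ▸ h ⟨M, hM⟩

end HigherOrder

theorem mainTheorem7 :
    -- the equivalence `UCADS ↔ (μ²)`
    ProvableInRCA (UCADS ↔ᶠ Mu2) ∧
    -- the implication `(μ²) → UCADS` is explicit
    (∃ s₁ s₂ : ClosedTerm (Ty.two ⇒ Ty.one ⇒ Ty.one),
      ProvableInRCA (all Ty.two
        (isMu v0 →ᶠ isUCADS (ofClosed s₁ ⬝ v0) (ofClosed s₂ ⬝ v0)))) ∧
    -- the implication `UCADS → (μ²)` is explicit, in terms of `Φ = (v3, v2)`, an extensionality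
    -- functional `v1` for `Φ`, and a witness `v0` to the infinity of the suborders
    (∃ u : ClosedTerm ((Ty.one ⇒ Ty.one) ⇒ (Ty.one ⇒ Ty.one) ⇒
          (Ty.one ⇒ Ty.one ⇒ Ty.N ⇒ Ty.N) ⇒ (Ty.one ⇒ Ty.N ⇒ Ty.N) ⇒ Ty.two),
      ProvableInRCA (all (Ty.one ⇒ Ty.one) (all (Ty.one ⇒ Ty.one)
        (all (Ty.one ⇒ Ty.one ⇒ Ty.N ⇒ Ty.N) (all (Ty.one ⇒ Ty.N ⇒ Ty.N)
          (isUCADS v3 v2 →ᶠ isExtensionalityFunctional v1 v3 v2 →ᶠ isInfinityWitness v0 v3 →ᶠ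
            isMu (ofClosed u ⬝ v3 ⬝ v2 ⬝ v1 ⬝ v0))))))) ∧
    -- and these two auxiliary functionals always exist
    ProvableInRCA (all (Ty.one ⇒ Ty.one) (all (Ty.one ⇒ Ty.one)
      (isUCADS v1 v0 →ᶠ
        ex (Ty.one ⇒ Ty.one ⇒ Ty.N ⇒ Ty.N) (isExtensionalityFunctional v0 v2 v1)
        ∧ᶠ ex (Ty.one ⇒ Ty.N ⇒ Ty.N) (isInfinityWitness v0 v2)))) := by
  refine ⟨provableInRCA fun M => ?_, ⟨Term.suborderC, Term.witnessC, provableInRCA fun M => ?_⟩,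
    ⟨Term.searchOperatorC, provableInRCA fun M => ?_⟩, provableInRCA fun M => ?_⟩
  · simp only [UCADS, Mu2, Model.sat_iff, Model.sat_ex, RCAModel.sat_isUCADS, RCAModel.sat_isMu,
      Model.eval_var,
      Model.consEnv_new, Model.consEnv_old]
    exact ⟨fun ⟨Φ₁, Φ₂, hΦ⟩ => RCAModel.exists_isMu hΦ,
      fun ⟨m, hm⟩ => ⟨_, _, RCAModel.isUCADS_of_isMu hm⟩⟩
  · simp only [Model.sat_all, Model.sat_imp, RCAModel.sat_isUCADS, RCAModel.sat_isMu, Model.eval_app,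
      Model.eval_ofClosed, Model.eval_var, Model.consEnv_new]
    exact fun m hm => RCAModel.isUCADS_of_isMu hm
  · simp only [Model.sat_all, Model.sat_imp, RCAModel.sat_isUCADS, RCAModel.sat_isMu,
      RCAModel.sat_isExtensionalityFunctional,
      RCAModel.sat_isInfinityWitness, Model.eval_app, Model.eval_ofClosed, Model.eval_var,
      Model.consEnv_new, Model.consEnv_old]
    intro Φ₁ Φ₂ Ξ Z hΦ hΞ hZ
    have h := hZ _ RCAModel.isLOinf_naturalC
    -- The two elements are `y₀ = Z(X₀, 0)` and `y₁ = Z(X₀, y₀)`, for the natural order `X₀`.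
    simpa [Term.searchOperatorC] using RCAModel.isMu_of_isUCADS hΦ hΞ (h _).1 (h 0).2 (h _).2
  · simp only [Model.sat_all, Model.sat_imp, Model.sat_and, Model.sat_ex, RCAModel.sat_isUCADS,
      RCAModel.sat_isExtensionalityFunctional, RCAModel.sat_isInfinityWitness, Model.eval_var,
      Model.consEnv_new,
      Model.consEnv_old]
    intro Φ₁ Φ₂ hΦ
    obtain ⟨m, hm⟩ := RCAModel.exists_isMu hΦ
    exact ⟨RCAModel.exists_isExtensionality Φ₁ Φ₂, RCAModel.exists_isInfinity hm hΦ⟩
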